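/- Let $d\ge 0$ be an integer, $\alpha\in(1,2)$, $p\in(0,\min(\tfrac12,\alpha-1))$, $\eta,\sigma>0$, $K_1,K_2,B,m,K>0$ and $D\in\mathbb{R}$. Then there is a finite constant $\hat C_\gamma>0$, depending only on $d,\alpha,p,\eta,\sigma,K_1,K_2,B,m,K,D$, such that the following holds. Let $\mathcal X$ be a subset of a normed space with $\|x-\hat x\|\le D$ for all $x,\hat x\in\mathcal X$, and let $f$ be a real-valued loss, with $f(\cdot,x):\mathbb{R}^d\to\mathbb{R}$ differentiable for every $x\in\mathcal X$, such that for all $\theta,\hat\theta\in\mathbb{R}^d$ and $x,\hat x\in\mathcal X$ $$\|\nabla f(\theta,x)-\nabla f(\hat\theta,\hat x)\|\le K_1\|\theta-\hat\theta\|+K_2\|x-\hat x\|\,(\|\theta\|+\|\hat\theta\|+1),$$ $$\|\nabla f(0,x)\|\le B,\qquad \langle\nabla f(\theta,x)-\nabla f(\hat\theta,x),\theta-\hat\theta\rangle\ge m\|\theta-\hat\theta\|^2-K ,$$ where gradients are taken in the first variable. Let $n\ge1$, let $X_n=(x_1,\dots,x_n)$ and $\hat X_n=(\hat x_1,\dots,\hat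 x_n)$ in $\mathcal X^n$ differ in at most one entry, and put $F(\theta,X_n)=\frac1n\sum_{i=1}^n f(\theta,x_i)$, and likewise $F(\theta,\hat X_n)$. Let $\xi$ be a random vector in $\mathbb{R}^d$ with the rotationally invariant $\alpha$-stable law, $\mathbb{E}[e^{\mathrm{i}u^\top\xi}]=e^{-\|u\|^\alpha}$ for $u\in\mathbb{R}^d$. Let $P$ and $\hat P$ be the one-step transition kernels of noisy gradient descent on the two data sets: $P(\theta,\cdot)$ is the law of $\theta-\eta\nabla F(\theta,X_n)+\sigma\xi$, and $\hat P(\theta,\cdot)$ is the law of $\theta-\eta\nabla F(\theta,\hat X_n)+\sigma\xi$. Let $\theta_\star,\hat\theta_\star\in\mathbb{R}^d$ be any stable points of the two objectives, i.e. $\nabla F(\theta_\star,X_n)=0$ and $\nabla F(\hat\theta_\star,\hat X_n)=0$, and set $$V_p(\theta)=(1+\|\theta-\theta_\star\|^2)^{p/2},\qquad \hat V_p(\theta)=(1+\|\theta-\hat\theta_\star\|^2)^{(1+p)/2}.$$ Then, for every $\theta\in\mathbb{R}^d$, $V_p$ is integrable with respect to $P(\theta,\cdot)$ and $\hat P(\theta,\cdot)$,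 and $$\sup_{\theta\in\mathbb{R}^d}\frac{\|P(\theta,\cdot)-\hat P(\theta,\cdot)\|_{V_p}}{\hat V_p(\theta)}\le\frac{\hat C_\gamma}{n},$$ where $\|\mu-\nu\|_V=\sup_{|g|\le V}\left|\int g\,d\mu-\int g\,d\nu\right|$, the supremum being over measurable $g:\mathbb{R}^d\to\mathbb{R}$ with $|g|\le V$. The existence of a point at which $\nabla f(\cdot,x)$ vanishes for all $x\in\mathcal X$ simultaneously is not assumed. -/

import Mathlib

open MeasureTheory ProbabilityTheory
open scoped ENNReal

namespace NoisyGD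

/-- The parameter space `ℝ^d` with its Euclidean norm. -/
abbrev Param (d : ℕ) : Type := EuclideanSpace ℝ (Fin d)

/-- The rotationally invariant `α`-stable distribution on `ℝ^d`: the probability measure whose
characteristic function is `u ↦ exp (-‖u‖ ^ α)` (the value `1` at `u = 0` forces total mass `1`). -/
def IsRotInvStable {d : ℕ} (α : ℝ) (ν : Measure (Param d)) : Prop :=
  ∀ u : Param d, charFun ν u = ((Real.exp (-(‖u‖ ^ α)) : ℝ) : ℂ)

/-- Empirical risk `F(θ, X) = (1/n) ∑ i, f(θ, x_i)`. -/
noncomputable def empRisk {d n : ℕ} {E : Type*} (f : Param d → E → ℝ) (X : Fin n → E)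
    (θ : Param d) : ℝ :=
  (n : ℝ)⁻¹ * ∑ i, f θ (X i)

/-- Pseudo-Lipschitz continuity of the gradient of the loss, for data in `𝒳`. -/
structure PseudoLipschitzGrad {d : ℕ} {E : Type*} [NormedAddCommGroup E] (𝒳 : Set E)
    (f : Param d → E → ℝ) (K₁ K₂ : ℝ) : Prop where
  differentiable : ∀ x ∈ 𝒳, Differentiable ℝ (fun θ => f θ x)
  bound : ∀ x ∈ 𝒳, ∀ x' ∈ 𝒳, ∀ θ θ' : Param d,
    ‖gradient (fun ϑ => f ϑ x) θ - gradient (fun ϑ => f ϑ x') θ'‖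
      ≤ K₁ * ‖θ - θ'‖ + K₂ * ‖x - x'‖ * (‖θ‖ + ‖θ'‖ + 1)

/-- Uniform dissipativity of the loss, for data in `𝒳`. -/
structure Dissipative {d : ℕ} {E : Type*} (𝒳 : Set E)
    (f : Param d → E → ℝ) (B m K : ℝ) : Prop where
  grad_zero : ∀ x ∈ 𝒳, ‖gradient (fun ϑ => f ϑ x) 0‖ ≤ B
  dissip : ∀ x ∈ 𝒳, ∀ θ₁ θ₂ : Param d,
    m * ‖θ₁ - θ₂‖ ^ 2 - K
      ≤ inner ℝ (gradient (fun ϑ => f ϑ x) θ₁ - gradient (fun ϑ => f ϑ x) θ₂) (θ₁ - θ₂)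

/-- Two data sets of size `n` that differ in at most one entry. -/
def Neighboring {n : ℕ} {E : Type*} (X X' : Fin n → E) : Prop :=
  ∃ i, ∀ j, j ≠ i → X j = X' j

/-- One step of noisy gradient descent on the objective `F`, started at `θ` with noise value `ξ`. -/
noncomputable def gdStep {d : ℕ} (η σ : ℝ) (F : Param d → ℝ) (θ ξ : Param d) : Param d :=
  θ - η • gradient F θ + σ • ξ

theorem measurable_gdStep {d : ℕ} (η σ : ℝ) (F : Param d → ℝ) :
    Measurable (Function.uncurry (gdStep η σ F)) := by
  have hg : Measurable (gradient F) :=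
    (InnerProductSpace.toDual ℝ (Param d)).symm.continuous.measurable.comp
      (measurable_fderiv ℝ F)
  unfold gdStep Function.uncurry
  exact (measurable_fst.sub ((hg.comp measurable_fst).const_smul η)).add
    (measurable_snd.const_smul σ)

/-- The transition kernel of `θ_k = θ_{k-1} - η ∇F(θ_{k-1}) + σ ξ_k` with i.i.d. noise `ξ_k ∼ ν`:
the measure at `θ` is the law of `θ - η ∇F(θ) + σ ξ` for `ξ ∼ ν`. -/
noncomputable def gdKernel {d : ℕ} (η σ : ℝ) (F : Param d → ℝ) (ν : Measure (Param d))
    [SFinite ν] : Kernel (Param d) (Param d) where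
  toFun θ := ν.map (gdStep η σ F θ)
  measurable' := by
    refine Measure.measurable_of_measurable_coe _ fun s hs => ?_
    have h : ∀ θ : Param d, ν.map (gdStep η σ F θ) s
        = ν (Prod.mk θ ⁻¹' (Function.uncurry (gdStep η σ F) ⁻¹' s)) := fun θ => by
      have hθ : Measurable (gdStep η σ F θ) :=
        (measurable_gdStep η σ F).comp measurable_prodMk_left
      rw [Measure.map_apply hθ hs]
      rfl
    simp_rw [h]
    exact measurable_measure_prodMk_left (measurable_gdStep η σ F hs)

/-- The `V`-norm `‖μ - ν‖_V`, the supremum of `|∫ g dμ - ∫ g dν|` over measurable `g` with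
`|g| ≤ V`. It is meant for `V` integrable with respect to both measures. -/
noncomputable def vNorm {d : ℕ} (V : Param d → ℝ) (μ ν : Measure (Param d)) : ℝ≥0∞ :=
  ⨆ (g : Param d → ℝ) (_ : Measurable g ∧ ∀ y, |g y| ≤ V y),
    ENNReal.ofReal |∫ y, g y ∂μ - ∫ y, g y ∂ν|

/-- The quantity `sup_θ ‖P(θ, ·) - P'(θ, ·)‖_V / V'(θ)` for positive `V'`. -/
noncomputable def kernelDist {d : ℕ} (V V' : Param d → ℝ) (P P' : Kernel (Param d) (Param d)) :
    ℝ≥0∞ :=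
  ⨆ θ : Param d, (vNorm V (P θ) (P' θ) / ENNReal.ofReal (V' θ))

/-- The Lyapunov function `θ ↦ (1 + ‖θ - c‖²)^(q/2)` centred at `c`. -/
noncomputable def lyap {d : ℕ} (q : ℝ) (c θ : Param d) : ℝ :=
  (1 + ‖θ - c‖ ^ 2) ^ (q / 2)

end NoisyGD

/-!
Subordination makes the stable law `ν` exactly a Gaussian variance mixture: it is the law of
`√(2 S) • Z`, with `S` positive `α / 2`-stable and `Z` an independent standard Gaussian vector.
Conditionally on `S`, the Gaussian density can be differentiated in place of the test function, so
that moving the starting point from `a'` to `a` changes the integral of a function of growth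
`(1 + ‖·‖) ^ p` by at most a multiple of
`(σ √(2 S))⁻¹ (1 + σ √(2 S)) ^ p ‖a - a'‖`. The expectation over `S` is finite because `S` has all
negative moments and the moments of every order below `α / 2`. The drifts on neighbouring data sets
differ by `O((1 + ‖θ‖) / n)`, and dissipativity confines the stable points to a fixed ball, so the
growth in `θ` is absorbed by `(1 + ‖θ - θs'‖ ^ 2) ^ ((1 + p) / 2)`.

The subordinator `S` is obtained as a limit point of rescaled sums of independent Pareto variables,
whose Laplace transforms converge to `exp (-y ^ (α / 2))`.
-/

namespace NoisyGD

open Filter Set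
open scoped Topology RealInnerProductSpace NNReal

section Weights

variable {V : Type*} [NormedAddCommGroup V] {p : ℝ}

theorem one_add_norm_add_rpow_le (hp : 0 ≤ p) (x y : V) :
    (1 + ‖x + y‖) ^ p ≤ (1 + ‖x‖) ^ p * (1 + ‖y‖) ^ p := by
  rw [← Real.mul_rpow (by positivity) (by positivity)]
  gcongr
  nlinarith [norm_add_le x y, norm_nonneg x, norm_nonneg y]

theorem one_add_norm_smul_rpow_le [NormedSpace ℝ V] (hp : 0 ≤ p) (t : ℝ) (x : V) :
    (1 + ‖t • x‖) ^ p ≤ (1 + |t|) ^ p * (1 + ‖x‖) ^ p := by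
  rw [← Real.mul_rpow (by positivity) (by positivity), norm_smul, Real.norm_eq_abs]
  gcongr
  nlinarith [abs_nonneg t, norm_nonneg x]

theorem abs_comp_add_smul_le [NormedSpace ℝ V] (hp : 0 ≤ p) {h : V → ℝ} {c : V}
    (hbound : ∀ y, |h y| ≤ (1 + ‖y - c‖) ^ p) {a : V} {R : ℝ} (ha : ‖a - c‖ ≤ R) (t : ℝ) (z : V) :
    |h (a + t • z)| ≤ (1 + R) ^ p * (1 + |t|) ^ p * (1 + ‖z‖) ^ p := by
  have hR : 0 ≤ R := (norm_nonneg _).trans ha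
  calc |h (a + t • z)| ≤ (1 + ‖(a - c) + t • z‖) ^ p := by
        simpa only [add_sub_right_comm] using hbound (a + t • z)
    _ ≤ (1 + ‖a - c‖) ^ p * (1 + ‖t • z‖) ^ p := one_add_norm_add_rpow_le hp _ _
    _ ≤ (1 + R) ^ p * ((1 + |t|) ^ p * (1 + ‖z‖) ^ p) := by
        gcongr
        exact one_add_norm_smul_rpow_le hp t z
    _ = (1 + R) ^ p * (1 + |t|) ^ p * (1 + ‖z‖) ^ p := (mul_assoc _ _ _).symm

theorem integrable_comp_add_smul [NormedSpace ℝ V] [MeasurableSpace V] [BorelSpace V]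
    [SecondCountableTopology V] {μ : Measure V} (hp : 0 ≤ p)
    (hμ : Integrable (fun z => (1 + ‖z‖) ^ p) μ) {h : V → ℝ} (hh : Measurable h) {c : V}
    (hbound : ∀ y, |h y| ≤ (1 + ‖y - c‖) ^ p) (a : V) (t : ℝ) :
    Integrable (fun z => h (a + t • z)) μ :=
  (hμ.const_mul ((1 + ‖a - c‖) ^ p * (1 + |t|) ^ p)).mono'
    (hh.comp (by fun_prop)).aestronglyMeasurable <|
    ae_of_all _ fun z => abs_comp_add_smul_le hp hbound le_rfl t z

end Weights

section Translation

variable {V : Type*} [NormedAddCommGroup V] [NormedSpace ℝ V]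

theorem enorm_sub_le_lintegral_fderiv {φ : V → ℝ} (hφ : ContDiff ℝ 1 φ) (z v : V) :
    ‖φ z - φ (z - v)‖ₑ ≤ ∫⁻ r in Ioc (0 : ℝ) 1, ‖fderiv ℝ φ (z - r • v)‖ₑ * ‖v‖ₑ := by
  have hderiv (r : ℝ) :
      HasDerivAt (fun r : ℝ => φ (z - r • v)) (fderiv ℝ φ (z - r • v) (-v)) r := by
    have hline : HasDerivAt (fun r : ℝ => z - r • v) (-v) r := by
      simpa using ((hasDerivAt_id r).smul_const v).const_sub z
    exact ((hφ.differentiable one_ne_zero _).hasFDerivAt).comp_hasDerivAt r hline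
  have hcont : Continuous fun r : ℝ => fderiv ℝ φ (z - r • v) (-v) :=
    ((hφ.continuous_fderiv one_ne_zero).comp (by fun_prop)).clm_apply continuous_const
  have hFTC := intervalIntegral.integral_eq_sub_of_hasDerivAt (a := 0) (b := 1)
    (fun r _ => hderiv r) (hcont.intervalIntegrable 0 1)
  simp only [one_smul, zero_smul, sub_zero] at hFTC
  rw [← enorm_neg, neg_sub, ← hFTC, intervalIntegral.integral_of_le zero_le_one]
  refine (enorm_integral_le_lintegral_enorm _).trans (lintegral_mono fun r => ?_)
  simpa only [enorm_neg] using (fderiv ℝ φ (z - r • v)).le_opENorm (-v)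

theorem lintegral_mul_enorm_sub_translate_le [MeasurableSpace V] [BorelSpace V]
    [SecondCountableTopology V] {μ : Measure V} [SFinite μ] [μ.IsAddRightInvariant]
    {φ : V → ℝ} (hφ : ContDiff ℝ 1 φ) {W : V → ℝ≥0∞} (hW : Measurable W) (v : V) {A : ℝ≥0∞}
    (hA : ∀ r ∈ Ioc (0 : ℝ) 1, ∫⁻ z, W (z + r • v) * ‖fderiv ℝ φ z‖ₑ ∂μ ≤ A) :
    ∫⁻ z, W z * ‖φ z - φ (z - v)‖ₑ ∂μ ≤ A * ‖v‖ₑ := by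
  have hφ' : Continuous (fderiv ℝ φ) := hφ.continuous_fderiv one_ne_zero
  have hD : Measurable fun z => ‖fderiv ℝ φ z‖ₑ := hφ'.enorm.measurable
  have hD' (z : V) : Measurable fun r : ℝ => ‖fderiv ℝ φ (z - r • v)‖ₑ * ‖v‖ₑ :=
    (hD.comp (by fun_prop)).mul_const _
  calc ∫⁻ z, W z * ‖φ z - φ (z - v)‖ₑ ∂μ
      ≤ ∫⁻ z, (∫⁻ r in Ioc (0 : ℝ) 1, W z * (‖fderiv ℝ φ (z - r • v)‖ₑ * ‖v‖ₑ)) ∂μ := by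
        refine lintegral_mono fun z => ?_
        rw [lintegral_const_mul _ (hD' z)]
        gcongr
        exact enorm_sub_le_lintegral_fderiv hφ z v
    _ = ∫⁻ r in Ioc (0 : ℝ) 1, ∫⁻ z, W z * (‖fderiv ℝ φ (z - r • v)‖ₑ * ‖v‖ₑ) ∂μ := by
        refine lintegral_lintegral_swap (Measurable.aemeasurable ?_)
        exact (hW.comp measurable_fst).mul ((hD.comp (by fun_prop)).mul_const _)
    _ = ∫⁻ r in Ioc (0 : ℝ) 1, (∫⁻ z, W (z + r • v) * ‖fderiv ℝ φ z‖ₑ ∂μ) * ‖v‖ₑ := by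
        refine lintegral_congr fun r => ?_
        rw [← lintegral_add_right_eq_self _ (r • v), ← lintegral_mul_const _ (by fun_prop)]
        simp only [add_sub_cancel_right, mul_assoc]
    _ ≤ ∫⁻ _ in Ioc (0 : ℝ) 1, A * ‖v‖ₑ := by
        refine setLIntegral_mono measurable_const fun r hr => ?_
        gcongr
        exact hA r hr
    _ = A * ‖v‖ₑ := by simp

end Translation

section Gaussian

variable {V : Type*} [NormedAddCommGroup V] [InnerProductSpace ℝ V]

/-- The density of the standard Gaussian law of `V` with respect to Lebesgue measure. -/
noncomputable def gaussianDensity (z : V) : ℝ :=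
  (2 * Real.pi) ^ (-(Module.finrank ℝ V / 2 : ℝ)) * Real.exp (-(‖z‖ ^ 2 / 2))

theorem gaussianDensity_pos (z : V) : 0 < gaussianDensity z := by
  unfold gaussianDensity
  positivity

theorem contDiff_gaussianDensity {n : WithTop ℕ∞} : ContDiff ℝ n (gaussianDensity (V := V)) :=
  contDiff_const.mul ((contDiff_norm_sq ℝ).div_const 2).neg.exp

theorem fderiv_gaussianDensity (z : V) :
    fderiv ℝ gaussianDensity z = -(gaussianDensity z • innerSL ℝ z) := by
  have hderiv := (((hasStrictFDerivAt_norm_sq z).hasFDerivAt.mul_const (2 : ℝ)⁻¹).neg.exp).const_mul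
    ((2 * Real.pi) ^ (-(Module.finrank ℝ V / 2 : ℝ)))
  simp only [← div_eq_mul_inv] at hderiv
  refine hderiv.fderiv.trans ?_
  rw [← Nat.cast_smul_eq_nsmul ℝ 2, Nat.cast_two, inv_smul_smul₀ two_ne_zero, smul_neg, smul_neg,
    smul_smul]
  rfl

theorem norm_fderiv_gaussianDensity (z : V) :
    ‖fderiv ℝ gaussianDensity z‖ = ‖z‖ * gaussianDensity z := by
  rw [fderiv_gaussianDensity, norm_neg, norm_smul, innerSL_apply_norm,
    Real.norm_of_nonneg (gaussianDensity_pos z).le, mul_comm]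

theorem continuous_gaussianDensity : Continuous (gaussianDensity (V := V)) :=
  contDiff_gaussianDensity (n := 0).continuous

variable [FiniteDimensional ℝ V] [MeasurableSpace V] [BorelSpace V]

theorem integrable_gaussianDensity : Integrable (gaussianDensity (V := V)) := by
  have h := (GaussianFourier.integrable_cexp_neg_mul_sq_norm_add (V := V) (b := (1 / 2 : ℂ))
    (by norm_num) 0 0).norm
  refine (h.congr (ae_of_all _ fun z => ?_)).const_mul _
  simp [Complex.norm_exp, ← Complex.ofReal_pow, inv_mul_eq_div]

theorem integral_gaussianDensity_mul_cexp_inner (t : V) :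
    ∫ z : V, gaussianDensity z • Complex.exp (⟪z, t⟫ * Complex.I) = Complex.exp (-‖t‖ ^ 2 / 2) := by
  have hfourier := GaussianFourier.integral_cexp_neg_mul_sq_norm_add (V := V) (b := (1 / 2 : ℂ))
    (by norm_num) Complex.I t
  have hpow : ((Real.pi : ℂ) / (1 / 2)) ^ (Module.finrank ℝ V / 2 : ℂ)
      = (((2 * Real.pi) ^ (Module.finrank ℝ V / 2 : ℝ) : ℝ) : ℂ) := by
    rw [Complex.ofReal_cpow (by positivity)]
    push_cast
    ring_nf
  calc ∫ z : V, gaussianDensity z • Complex.exp (⟪z, t⟫ * Complex.I)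
      = ∫ z : V, (((2 * Real.pi) ^ (-(Module.finrank ℝ V / 2 : ℝ)) : ℝ) : ℂ)
          * Complex.exp (-(1 / 2) * ‖z‖ ^ 2 + Complex.I * ⟪t, z⟫) := by
        congr with z
        rw [gaussianDensity, Complex.exp_add, Complex.real_smul, real_inner_comm]
        push_cast
        ring_nf
    _ = Complex.exp (-‖t‖ ^ 2 / 2) := by
        rw [integral_const_mul, hfourier, hpow, ← mul_assoc, ← Complex.ofReal_mul,
          ← Real.rpow_add (by positivity), neg_add_cancel, Real.rpow_zero, Complex.ofReal_one,
          one_mul, Complex.I_sq]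
        ring_nf

theorem stdGaussian_eq_withDensity :
    stdGaussian V = volume.withDensity fun z => ENNReal.ofReal (gaussianDensity z) := by
  have := isFiniteMeasure_withDensity_ofReal (integrable_gaussianDensity (V := V)).2
  refine Measure.ext_of_charFun (funext fun t => ?_)
  rw [charFun_stdGaussian, charFun_apply, integral_withDensity_eq_integral_toReal_smul
    continuous_gaussianDensity.measurable.ennreal_ofReal (by simp)]
  simp only [ENNReal.toReal_ofReal (gaussianDensity_pos _).le,
    integral_gaussianDensity_mul_cexp_inner]

theorem lintegral_stdGaussian (g : V → ℝ≥0∞) :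
    ∫⁻ z, g z ∂stdGaussian V = ∫⁻ z, g z * ENNReal.ofReal (gaussianDensity z) := by
  rw [stdGaussian_eq_withDensity, lintegral_withDensity_eq_lintegral_mul_non_measurable _
    continuous_gaussianDensity.measurable.ennreal_ofReal (by simp)]
  simp only [Pi.mul_apply, mul_comm]

theorem integral_stdGaussian (g : V → ℝ) :
    ∫ z, g z ∂stdGaussian V = ∫ z, g z * gaussianDensity z := by
  rw [stdGaussian_eq_withDensity, integral_withDensity_eq_integral_toReal_smul
    continuous_gaussianDensity.measurable.ennreal_ofReal (by simp)]
  simp only [ENNReal.toReal_ofReal (gaussianDensity_pos _).le, smul_eq_mul, mul_comm]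

theorem integrable_stdGaussian_iff {g : V → ℝ} :
    Integrable g (stdGaussian V) ↔ Integrable fun z => g z * gaussianDensity z := by
  rw [stdGaussian_eq_withDensity, integrable_withDensity_iff_integrable_smul'
    continuous_gaussianDensity.measurable.ennreal_ofReal (by simp)]
  simp only [ENNReal.toReal_ofReal (gaussianDensity_pos _).le, smul_eq_mul, mul_comm]

theorem enorm_integral_stdGaussian_translate_sub_le {h : V → ℝ} (hh : Measurable h) (v : V)
    (hint : Integrable h (stdGaussian V)) (hint' : Integrable (fun z => h (z + v)) (stdGaussian V))
    {A : ℝ≥0∞}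
    (hA : ∀ r ∈ Ioc (0 : ℝ) 1, ∫⁻ z, ‖h (z + r • v)‖ₑ * ‖z‖ₑ ∂stdGaussian V ≤ A) :
    ‖∫ z, h (z + v) ∂stdGaussian V - ∫ z, h z ∂stdGaussian V‖ₑ ≤ A * ‖v‖ₑ := by
  have htranslate : ∫ z, h (z + v) * gaussianDensity z = ∫ z, h z * gaussianDensity (z - v) := by
    rw [← integral_add_right_eq_self (fun z => h z * gaussianDensity (z - v)) v]
    simp only [add_sub_cancel_right]
  have hint'' : Integrable fun z => h z * gaussianDensity (z - v) := by
    simpa only [sub_add_cancel] using (integrable_stdGaussian_iff.1 hint').comp_sub_right v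
  rw [integral_stdGaussian, integral_stdGaussian, htranslate,
    ← integral_sub hint'' (integrable_stdGaussian_iff.1 hint)]
  calc ‖∫ z, (h z * gaussianDensity (z - v) - h z * gaussianDensity z)‖ₑ
      ≤ ∫⁻ z, ‖h z * gaussianDensity (z - v) - h z * gaussianDensity z‖ₑ :=
        enorm_integral_le_lintegral_enorm _
    _ = ∫⁻ z, ‖h z‖ₑ * ‖gaussianDensity z - gaussianDensity (z - v)‖ₑ := by
        simp only [← mul_sub, enorm_mul, enorm_sub_rev (gaussianDensity (_ - v))]
    _ ≤ A * ‖v‖ₑ := by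
        refine lintegral_mul_enorm_sub_translate_le contDiff_gaussianDensity hh.enorm v
          fun r hr => (le_of_eq ?_).trans (hA r hr)
        rw [lintegral_stdGaussian]
        refine lintegral_congr fun z => ?_
        rw [← ofReal_norm (fderiv ℝ _ z), norm_fderiv_gaussianDensity,
          ENNReal.ofReal_mul (norm_nonneg z), ofReal_norm, mul_assoc]

theorem integrable_one_add_norm_rpow_stdGaussian {q : ℝ} (hq : 0 ≤ q) :
    Integrable (fun z => (1 + ‖z‖) ^ q) (stdGaussian V) := by
  have hid := IsGaussian.memLp_id (stdGaussian V) (ENNReal.ofReal q) ENNReal.ofReal_ne_top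
  have hmem : MemLp (fun z : V => 1 + ‖z‖) (ENNReal.ofReal q) (stdGaussian V) :=
    (memLp_const (1 : ℝ)).add hid.norm
  refine hmem.integrable_norm_rpow'.congr (ae_of_all _ fun z => ?_)
  simp only [ENNReal.toReal_ofReal hq, Real.norm_of_nonneg (by positivity : 0 ≤ 1 + ‖z‖)]

theorem lintegral_enorm_affine_mul_enorm_stdGaussian_le {p : ℝ} (hp : 0 ≤ p) {h : V → ℝ}
    {c a : V} (hbound : ∀ y, |h y| ≤ (1 + ‖y - c‖) ^ p) {R : ℝ} (ha : ‖a - c‖ ≤ R) (t : ℝ) :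
    ∫⁻ z, ‖h (a + t • z)‖ₑ * ‖z‖ₑ ∂stdGaussian V
      ≤ ENNReal.ofReal
        ((1 + R) ^ p * (1 + |t|) ^ p * ∫ z, (1 + ‖z‖) ^ (p + 1) ∂stdGaussian V) := by
  have hR : 0 ≤ R := (norm_nonneg _).trans ha
  rw [← integral_const_mul, ofReal_integral_eq_lintegral_ofReal
    ((integrable_one_add_norm_rpow_stdGaussian (by positivity)).const_mul _)
    (ae_of_all _ fun z => by positivity)]
  refine lintegral_mono fun z => ?_
  rw [← ofReal_norm, ← ofReal_norm, ← ENNReal.ofReal_mul (norm_nonneg _), Real.norm_eq_abs,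
    Real.rpow_add_one (by positivity), ← mul_assoc]
  gcongr
  · exact abs_comp_add_smul_le hp hbound ha t z
  · linarith

theorem abs_integral_stdGaussian_affine_sub_le {p : ℝ} (hp : 0 ≤ p) {h : V → ℝ}
    (hh : Measurable h) {c a a' : V} (hbound : ∀ y, |h y| ≤ (1 + ‖y - c‖) ^ p) {R : ℝ}
    (ha : ‖a - c‖ ≤ R) (ha' : ‖a' - c‖ ≤ R) {t : ℝ} (ht : t ≠ 0) :
    |∫ z, h (a + t • z) ∂stdGaussian V - ∫ z, h (a' + t • z) ∂stdGaussian V|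
      ≤ (1 + R) ^ p * (1 + |t|) ^ p * (∫ z, (1 + ‖z‖) ^ (p + 1) ∂stdGaussian V)
        * (|t|⁻¹ * ‖a - a'‖) := by
  have hR : 0 ≤ R := (norm_nonneg _).trans ha
  have hint (b : V) : Integrable (fun z => h (b + t • z)) (stdGaussian V) :=
    integrable_comp_add_smul hp (integrable_one_add_norm_rpow_stdGaussian hp) hh hbound b t
  have hshift (r : ℝ) (z : V) :
      a' + t • (z + r • t⁻¹ • (a - a')) = a' + r • (a - a') + t • z := by
    rw [smul_add, smul_comm r, smul_inv_smul₀ ht]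
    abel
  have hend (z : V) : a' + t • (z + t⁻¹ • (a - a')) = a + t • z := by
    simpa using hshift 1 z
  have hsegment {r : ℝ} (hr : r ∈ Ioc (0 : ℝ) 1) : ‖a' + r • (a - a') - c‖ ≤ R :=
    mem_closedBall_iff_norm.1 <| (convex_closedBall c R).add_smul_sub_mem
      (mem_closedBall_iff_norm.2 ha') (mem_closedBall_iff_norm.2 ha) (Ioc_subset_Icc_self hr)
  have hbase := enorm_integral_stdGaussian_translate_sub_le (h := fun z => h (a' + t • z))
    (hh.comp (by fun_prop)) (t⁻¹ • (a - a')) (hint a') (by simpa only [hend] using hint a)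
    fun r hr => by
      simpa only [hshift] using
        lintegral_enorm_affine_mul_enorm_stdGaussian_le hp hbound (hsegment hr) t
  simp only [hend] at hbase
  rwa [← ofReal_norm, ← ofReal_norm, ← ENNReal.ofReal_mul (by positivity), norm_smul, norm_inv,
    ENNReal.ofReal_le_ofReal_iff (by positivity), Real.norm_eq_abs, Real.norm_eq_abs] at hbase

end Gaussian

section LevyIntegral

variable {q r : ℝ}

theorem one_sub_exp_neg_nonneg {x : ℝ} (hx : 0 ≤ x) : 0 ≤ 1 - Real.exp (-x) :=
  sub_nonneg.2 (Real.exp_le_one_iff.2 (neg_nonpos.2 hx))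

theorem rpow_mul_one_sub_exp_neg_nonneg {u x : ℝ} (hu : 0 ≤ u) (hx : 0 ≤ x) (s : ℝ) :
    0 ≤ u ^ s * (1 - Real.exp (-x)) :=
  mul_nonneg (Real.rpow_nonneg hu s) (one_sub_exp_neg_nonneg hx)

theorem integrableOn_rpow_mul_one_sub_exp_neg_rpow (hq : 0 < q) (hqr : q < r) :
    IntegrableOn (fun u : ℝ => u ^ (-(q + 1)) * (1 - Real.exp (-u ^ r))) (Ioi 0) := by
  have hmeas : Measurable fun u : ℝ => u ^ (-(q + 1)) * (1 - Real.exp (-u ^ r)) := by fun_prop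
  have hnorm {u : ℝ} (hu : 0 < u) : ‖u ^ (-(q + 1)) * (1 - Real.exp (-u ^ r))‖
      = u ^ (-(q + 1)) * (1 - Real.exp (-u ^ r)) :=
    Real.norm_of_nonneg (rpow_mul_one_sub_exp_neg_nonneg hu.le (by positivity) _)
  rw [← Ioc_union_Ioi_eq_Ioi zero_le_one]
  refine IntegrableOn.union ?near_zero ?near_infinity
  case near_zero =>
    have hdom : IntegrableOn (fun u : ℝ => u ^ (r - q - 1)) (Ioc 0 1) :=
      (intervalIntegrable_iff_integrableOn_Ioc_of_le zero_le_one).1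
        (intervalIntegral.intervalIntegrable_rpow' (by linarith))
    refine hdom.mono' hmeas.aestronglyMeasurable ?_
    filter_upwards [ae_restrict_mem measurableSet_Ioc] with u hu
    rw [hnorm hu.1]
    calc u ^ (-(q + 1)) * (1 - Real.exp (-u ^ r)) ≤ u ^ (-(q + 1)) * u ^ r := by
          gcongr
          · exact Real.rpow_nonneg hu.1.le _
          · linarith [Real.one_sub_le_exp_neg (u ^ r)]
      _ = u ^ (r - q - 1) := by
          rw [← Real.rpow_add hu.1]
          ring_nf
  case near_infinity =>
    have hdom : IntegrableOn (fun u : ℝ => u ^ (-(q + 1))) (Ioi 1) :=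
      integrableOn_Ioi_rpow_of_lt (by linarith) one_pos
    refine hdom.mono' hmeas.aestronglyMeasurable ?_
    filter_upwards [ae_restrict_mem measurableSet_Ioi] with u hu
    have hu0 : 0 < u := one_pos.trans hu
    rw [hnorm hu0]
    exact mul_le_of_le_one_right (by positivity) (by linarith [Real.exp_pos (-u ^ r)])

theorem integrableOn_rpow_mul_one_sub_exp_neg (hq : 0 < q) (hq1 : q < 1) :
    IntegrableOn (fun u : ℝ => u ^ (-(q + 1)) * (1 - Real.exp (-u))) (Ioi 0) := by
  simpa only [Real.rpow_one] using integrableOn_rpow_mul_one_sub_exp_neg_rpow hq hq1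

/-- The constant `c` of the Lévy–Khintchine identity
`c * x ^ q = ∫ u in Ioi 0, u ^ (-(q + 1)) * (1 - exp (-(x * u)))`, finite for `0 < q < 1`. -/
noncomputable def levyConstant (q : ℝ) : ℝ :=
  ∫ u in Ioi (0 : ℝ), u ^ (-(q + 1)) * (1 - Real.exp (-u))

theorem levyConstant_pos (hq : 0 < q) (hq1 : q < 1) : 0 < levyConstant q := by
  have hpos : ∀ u ∈ Ioi (0 : ℝ), 0 < u ^ (-(q + 1)) * (1 - Real.exp (-u)) := fun u hu =>
    mul_pos (Real.rpow_pos_of_pos hu _) (sub_pos.2 (Real.exp_lt_one_iff.2 (neg_neg_of_pos hu)))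
  refine (setIntegral_pos_iff_support_of_nonneg_ae
    ((ae_restrict_mem measurableSet_Ioi).mono fun u hu => (hpos u hu).le)
    (integrableOn_rpow_mul_one_sub_exp_neg hq hq1)).2 ?_
  rw [inter_eq_right.2 fun u hu => Function.mem_support.2 (hpos u hu).ne']
  simp

theorem setIntegral_Ioi_rpow_mul_one_sub_exp_neg_mul {y : ℝ} (hy : 0 < y) {a : ℝ} (ha : 0 ≤ a) :
    ∫ u in Ioi a, u ^ (-(q + 1)) * (1 - Real.exp (-(y * u)))
      = y ^ q * ∫ u in Ioi (y * a), u ^ (-(q + 1)) * (1 - Real.exp (-u)) := by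
  have hscale := integral_comp_mul_left_Ioi
    (fun u : ℝ => u ^ (-(q + 1)) * (1 - Real.exp (-u))) a hy
  have hcancel : y ^ (-(q + 1)) = y ^ (-q) * y⁻¹ := by
    rw [← Real.rpow_neg_one, ← Real.rpow_add hy]
    ring_nf
  have hfactor : ∀ u ∈ Ioi a, (y * u) ^ (-(q + 1)) * (1 - Real.exp (-(y * u)))
      = y ^ (-(q + 1)) * (u ^ (-(q + 1)) * (1 - Real.exp (-(y * u)))) := fun u hu => by
    rw [Real.mul_rpow hy.le (ha.trans (le_of_lt hu)), mul_assoc]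
  rw [setIntegral_congr_fun measurableSet_Ioi hfactor, integral_const_mul, hcancel,
    smul_eq_mul, mul_right_comm, mul_comm y⁻¹, Real.rpow_neg hy.le] at hscale
  rw [← mul_right_cancel₀ (inv_ne_zero hy.ne') hscale, mul_inv_cancel_left₀ (by positivity)]

theorem lintegral_rpow_mul_one_sub_exp_neg_mul (hq : 0 < q) (hq1 : q < 1) {x : ℝ} (hx : 0 ≤ x) :
    ∫⁻ u in Ioi (0 : ℝ), ENNReal.ofReal (u ^ (-(q + 1)) * (1 - Real.exp (-(x * u))))
      = ENNReal.ofReal (levyConstant q * x ^ q) := by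
  obtain rfl | hx := hx.eq_or_lt
  · simp [Real.zero_rpow hq.ne']
  have hintegral := setIntegral_Ioi_rpow_mul_one_sub_exp_neg_mul (q := q) hx le_rfl
  rw [mul_zero, mul_comm, ← levyConstant] at hintegral
  have hpos : levyConstant q * x ^ q ≠ 0 := by
    have := levyConstant_pos hq hq1
    positivity
  rw [← ofReal_integral_eq_lintegral_ofReal (Integrable.of_integral_ne_zero (hintegral ▸ hpos)),
    hintegral]
  filter_upwards [ae_restrict_mem measurableSet_Ioi] with u hu
  exact rpow_mul_one_sub_exp_neg_nonneg (le_of_lt hu) (mul_nonneg hx.le (le_of_lt hu)) _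

end LevyIntegral

section Laplace

/-- The Laplace transform `y ↦ ∫ exp (-(y * s)) dμ(s)` of a measure on `[0, ∞)`, meant for
`0 ≤ y`. -/
noncomputable def laplace (μ : Measure ℝ≥0) (y : ℝ) : ℝ :=
  ∫ s, Real.exp (-(y * s)) ∂μ

theorem norm_exp_neg_mul_le_one {y : ℝ} (hy : 0 ≤ y) (s : ℝ≥0) :
    ‖Real.exp (-(y * s))‖ ≤ 1 := by
  rw [Real.norm_of_nonneg (Real.exp_pos _).le, Real.exp_le_one_iff, neg_nonpos]
  positivity

theorem integrable_exp_neg_mul (μ : Measure ℝ≥0) [IsFiniteMeasure μ] {y : ℝ} (hy : 0 ≤ y) :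
    Integrable (fun s : ℝ≥0 => Real.exp (-(y * s))) μ :=
  .of_bound (by fun_prop) 1 (ae_of_all _ (norm_exp_neg_mul_le_one hy))

theorem integrable_one_sub_exp_neg_mul (μ : Measure ℝ≥0) [IsFiniteMeasure μ] {y : ℝ}
    (hy : 0 ≤ y) : Integrable (fun s : ℝ≥0 => 1 - Real.exp (-(y * s))) μ :=
  (integrable_const _).sub (integrable_exp_neg_mul μ hy)

theorem laplace_nonneg (μ : Measure ℝ≥0) (y : ℝ) : 0 ≤ laplace μ y :=
  integral_nonneg fun _ => (Real.exp_pos _).le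

theorem one_sub_laplace (μ : Measure ℝ≥0) [IsProbabilityMeasure μ] {y : ℝ} (hy : 0 ≤ y) :
    1 - laplace μ y = ∫ s : ℝ≥0, (1 - Real.exp (-(y * s))) ∂μ := by
  rw [integral_sub (integrable_const _) (integrable_exp_neg_mul μ hy), integral_const,
    probReal_univ, one_smul, laplace]

theorem mul_measureReal_Ici_le_one_sub_laplace (μ : Measure ℝ≥0) [IsProbabilityMeasure μ]
    {r : ℝ≥0} (hr : 0 < r) :
    (1 - Real.exp (-1)) * μ.real (Ici r) ≤ 1 - laplace μ (r : ℝ)⁻¹ := by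
  have hr' : (0 : ℝ) ≤ (r : ℝ)⁻¹ := by positivity
  rw [one_sub_laplace μ hr']
  refine le_trans ?_ (mul_meas_ge_le_integral_of_nonneg
    (ae_of_all _ fun s => one_sub_exp_neg_nonneg (by positivity))
    (integrable_one_sub_exp_neg_mul μ hr') (1 - Real.exp (-1)))
  have hexp : Real.exp (-1) < 1 := Real.exp_lt_one_iff.2 (by norm_num)
  refine mul_le_mul_of_nonneg_left (measureReal_mono fun s hs => ?_) (by linarith)
  have hrs : 1 ≤ (r : ℝ)⁻¹ * s := (one_le_inv_mul₀ (by positivity)).2 (mod_cast hs)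
  exact sub_le_sub_left (Real.exp_le_exp.2 (neg_le_neg hrs)) 1

theorem isTightMeasureSet_range_of_laplace {ι : Type*} {μ : ι → Measure ℝ≥0}
    [∀ i, IsProbabilityMeasure (μ i)] {M : ℝ → ℝ} (hM : Tendsto M (𝓝[>] 0) (𝓝 0))
    (hμ : ∀ i, ∀ y > 0, 1 - laplace (μ i) y ≤ M y) : IsTightMeasureSet (range μ) := by
  have hexp : 0 < 1 - Real.exp (-1) := sub_pos.2 (Real.exp_lt_one_iff.2 (by norm_num))
  refine isTightMeasureSet_iff_exists_isCompact_measure_compl_le.2 fun ε hε => ?_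
  obtain rfl | hε_top := eq_or_ne ε ∞
  · exact ⟨∅, isCompact_empty, fun _ _ => le_top⟩
  have hsmall : ∀ᶠ y in 𝓝[>] (0 : ℝ), M y < (1 - Real.exp (-1)) * ε.toReal :=
    hM.eventually_lt_const (mul_pos hexp (ENNReal.toReal_pos hε.ne' hε_top))
  obtain ⟨y, hy, hy0⟩ := (hsmall.and self_mem_nhdsWithin).exists
  lift y to ℝ≥0 using hy0.le
  refine ⟨Icc 0 y⁻¹, isCompact_Icc, ?_⟩
  rintro _ ⟨i, rfl⟩
  have hmarkov := mul_measureReal_Ici_le_one_sub_laplace (μ i) (inv_pos.2 (mod_cast hy0 : 0 < y))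
  rw [NNReal.coe_inv, inv_inv] at hmarkov
  have hreal : (μ i).real (Ici y⁻¹) ≤ ε.toReal :=
    le_of_mul_le_mul_left (hmarkov.trans ((hμ i y hy0).trans hy.le)) hexp
  calc μ i (Icc 0 y⁻¹)ᶜ ≤ μ i (Ici y⁻¹) :=
        measure_mono fun s hs => (lt_of_not_ge fun h => hs ⟨zero_le, h⟩).le
    _ ≤ ε := (ENNReal.toReal_le_toReal (measure_ne_top _ _) hε_top).1 hreal

theorem exists_laplace_eq_of_tendsto {μ : ℕ → ProbabilityMeasure ℝ≥0} {M L : ℝ → ℝ}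
    (hM : Tendsto M (𝓝[>] 0) (𝓝 0)) (hμ : ∀ n, ∀ y > 0, 1 - laplace (μ n) y ≤ M y)
    (hL : ∀ y, 0 ≤ y → Tendsto (fun n => laplace (μ n) y) atTop (𝓝 (L y))) :
    ∃ μ' : ProbabilityMeasure ℝ≥0, ∀ y, 0 ≤ y → laplace μ' y = L y := by
  have htight : IsTightMeasureSet {x | ∃ ν ∈ range μ, (ν : Measure ℝ≥0) = x} := by
    simp only [mem_range, exists_exists_eq_and]
    exact isTightMeasureSet_range_of_laplace hM hμ
  obtain ⟨μ', -, hμ'⟩ := (isCompact_closure_of_isTightMeasureSet htight).ultrafilter_le_nhds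
    ((hyperfilter ℕ).map μ)
    (le_principal_iff.2 (mem_of_superset (range_mem_map) subset_closure))
  refine ⟨μ', fun y hy => tendsto_nhds_unique ?_ ((hL y hy).mono_left Nat.hyperfilter_le_atTop)⟩
  exact ProbabilityMeasure.tendsto_iff_forall_integral_tendsto.1 hμ'
    (.ofNormedAddCommGroup (fun s : ℝ≥0 => Real.exp (-(y * s))) (by fun_prop) 1
      (norm_exp_neg_mul_le_one hy))

theorem exists_laplace_eq_pow (ρ : Measure ℝ≥0) [IsProbabilityMeasure ρ] (c : ℝ≥0) (n : ℕ) :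
    ∃ μ : ProbabilityMeasure ℝ≥0, ∀ y, laplace μ y = laplace ρ (c * y) ^ n := by
  have hsum : Measurable fun x : Fin n → ℝ≥0 => c * ∑ i, x i := by fun_prop
  have := Measure.isProbabilityMeasure_map (μ := Measure.pi fun _ : Fin n => ρ) hsum.aemeasurable
  refine ⟨⟨(Measure.pi fun _ : Fin n => ρ).map fun x => c * ∑ i, x i, this⟩, fun y => ?_⟩
  calc laplace ((Measure.pi fun _ : Fin n => ρ).map fun x => c * ∑ i, x i) y
      = ∫ x : Fin n → ℝ≥0, ∏ i, Real.exp (-(c * y * x i)) ∂Measure.pi fun _ => ρ := by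
        rw [laplace, integral_map hsum.aemeasurable (by fun_prop)]
        refine integral_congr_ae (ae_of_all _ fun x => ?_)
        simp only [← Real.exp_sum, Finset.sum_neg_distrib, ← Finset.mul_sum, NNReal.coe_mul,
          NNReal.coe_sum]
        ring_nf
    _ = laplace ρ (c * y) ^ n := by
        rw [integral_fintype_prod_eq_pow fun s : ℝ≥0 => Real.exp (-(c * y * s)), Fintype.card_fin,
          laplace]

end Laplace

section PositiveStable

variable {β : ℝ}

theorem integral_paretoMeasure_one (hβ : 0 < β) (g : ℝ → ℝ) :
    ∫ x, g x ∂paretoMeasure 1 β = ∫ x in Ioi (1 : ℝ), β * x ^ (-(β + 1)) * g x := by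
  have hpdf : Measurable (paretoPDF 1 β) := (measurable_paretoPDFReal 1 β).ennreal_ofReal
  rw [paretoMeasure, integral_withDensity_eq_integral_toReal_smul hpdf (by simp [paretoPDF]),
    ← integral_Ici_eq_integral_Ioi, ← integral_indicator measurableSet_Ici]
  refine integral_congr_ae (ae_of_all _ fun x => ?_)
  dsimp only
  rw [paretoPDF, ENNReal.toReal_ofReal (paretoPDFReal_nonneg zero_le_one hβ.le x), paretoPDFReal]
  by_cases hx : 1 ≤ x <;> simp [hx]

/-- The Pareto law with scale `1` and shape `β`, as a measure on `[0, ∞)`. -/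
noncomputable def paretoNNReal (β : ℝ) : Measure ℝ≥0 :=
  (paretoMeasure 1 β).map Real.toNNReal

theorem isProbabilityMeasure_paretoNNReal (hβ : 0 < β) :
    IsProbabilityMeasure (paretoNNReal β) :=
  have := isProbabilityMeasure_paretoMeasure one_pos hβ
  Measure.isProbabilityMeasure_map measurable_real_toNNReal.aemeasurable

theorem one_sub_laplace_paretoNNReal (hβ : 0 < β) {y : ℝ} (hy : 0 < y) :
    1 - laplace (paretoNNReal β) y
      = β * (y ^ β * ∫ u in Ioi y, u ^ (-(β + 1)) * (1 - Real.exp (-u))) := by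
  have := isProbabilityMeasure_paretoNNReal hβ
  have htail := setIntegral_Ioi_rpow_mul_one_sub_exp_neg_mul (q := β) hy zero_le_one
  rw [mul_one] at htail
  rw [one_sub_laplace _ hy.le, paretoNNReal, integral_map (by fun_prop) (by fun_prop),
    integral_paretoMeasure_one hβ, ← htail, ← integral_const_mul]
  refine setIntegral_congr_fun measurableSet_Ioi fun x hx => ?_
  simp only [Real.coe_toNNReal x (zero_le_one.trans (le_of_lt hx)), mul_assoc]

theorem one_sub_laplace_paretoNNReal_le (hβ : 0 < β) (hβ1 : β < 1) {y : ℝ} (hy : 0 < y) :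
    1 - laplace (paretoNNReal β) y ≤ β * levyConstant β * y ^ β := by
  rw [one_sub_laplace_paretoNNReal hβ hy, mul_assoc, mul_comm (levyConstant β)]
  gcongr
  refine setIntegral_mono_set (integrableOn_rpow_mul_one_sub_exp_neg hβ hβ1) ?_
    (Ioi_subset_Ioi hy.le).eventuallyLE
  filter_upwards [ae_restrict_mem measurableSet_Ioi] with u hu
  exact rpow_mul_one_sub_exp_neg_nonneg (le_of_lt hu) (le_of_lt hu) _

theorem tendsto_rpow_mul_one_sub_laplace_paretoNNReal (hβ : 0 < β) (hβ1 : β < 1) :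
    Tendsto (fun y => y ^ (-β) * (1 - laplace (paretoNNReal β) y)) (𝓝[>] 0)
      (𝓝 (β * levyConstant β)) := by
  have htail : Tendsto (fun y => ∫ u in Ioi y, u ^ (-(β + 1)) * (1 - Real.exp (-u))) (𝓝[>] 0)
      (𝓝 (levyConstant β)) :=
    ((aecover_Ioi_of_Ioi
      (tendsto_id.mono_left nhdsWithin_le_nhds)).integral_tendsto_of_countably_generated
        (integrableOn_rpow_mul_one_sub_exp_neg hβ hβ1)).congr' <| by
      filter_upwards [self_mem_nhdsWithin] with y hy
      rw [Measure.restrict_restrict measurableSet_Ioi,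
        inter_eq_left.2 (Ioi_subset_Ioi (le_of_lt hy)), id]
  refine (htail.const_mul β).congr' ?_
  filter_upwards [self_mem_nhdsWithin] with y hy
  have hy : 0 < y := hy
  rw [one_sub_laplace_paretoNNReal hβ hy, mul_left_comm, ← mul_assoc (y ^ (-β)), ← Real.rpow_add hy,
    neg_add_cancel, Real.rpow_zero, one_mul]

/-- The factor `(β c (n + 1)) ^ (-1 / β)`, `c = levyConstant β`, by which the sum of `n + 1`
independent Pareto variables has to be rescaled in order to converge to a positive stable law. -/
noncomputable def paretoScale (β : ℝ) (n : ℕ) : ℝ :=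
  (β * levyConstant β * (n + 1)) ^ (-β⁻¹)

theorem paretoScale_pos (hβ : 0 < β) (hβ1 : β < 1) (n : ℕ) : 0 < paretoScale β n := by
  have := levyConstant_pos hβ hβ1
  unfold paretoScale
  positivity

theorem mul_paretoScale_rpow (hβ : 0 < β) (hβ1 : β < 1) (n : ℕ) :
    (n + 1) * (β * levyConstant β) * paretoScale β n ^ β = 1 := by
  have := levyConstant_pos hβ hβ1
  rw [paretoScale, ← Real.rpow_mul (by positivity), neg_mul, inv_mul_cancel₀ hβ.ne',
    Real.rpow_neg_one]
  field_simp

theorem tendsto_paretoScale (hβ : 0 < β) (hβ1 : β < 1) :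
    Tendsto (paretoScale β) atTop (𝓝 0) := by
  have hbase : Tendsto (fun n : ℕ => β * levyConstant β * ((n : ℝ) + 1)) atTop atTop :=
    (tendsto_natCast_atTop_atTop.atTop_add tendsto_const_nhds).const_mul_atTop
      (mul_pos hβ (levyConstant_pos hβ hβ1))
  exact (tendsto_rpow_neg_atTop (inv_pos.2 hβ)).comp hbase

theorem one_sub_laplace_paretoNNReal_pow_le (hβ : 0 < β) (hβ1 : β < 1) (n : ℕ) {y : ℝ}
    (hy : 0 < y) : 1 - laplace (paretoNNReal β) (paretoScale β n * y) ^ (n + 1) ≤ y ^ β := by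
  have hs := paretoScale_pos hβ hβ1 n
  set L := laplace (paretoNNReal β) (paretoScale β n * y)
  have hL : 0 ≤ L := laplace_nonneg _ _
  have hbernoulli : 1 + ((n + 1 : ℕ) : ℝ) * (L - 1) ≤ L ^ (n + 1) := by
    simpa using one_add_mul_le_pow (a := L - 1) (by linarith) (n + 1)
  have hbound : 1 - L ≤ β * levyConstant β * (paretoScale β n * y) ^ β :=
    one_sub_laplace_paretoNNReal_le hβ hβ1 (mul_pos hs hy)
  calc 1 - L ^ (n + 1) ≤ (n + 1) * (1 - L) := by push_cast at hbernoulli; linarith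
    _ ≤ (n + 1) * (β * levyConstant β * (paretoScale β n * y) ^ β) := by gcongr
    _ = y ^ β := by
        rw [Real.mul_rpow hs.le hy.le]
        linear_combination y ^ β * mul_paretoScale_rpow hβ hβ1 n

theorem tendsto_mul_one_sub_laplace_paretoNNReal (hβ : 0 < β) (hβ1 : β < 1) {y : ℝ}
    (hy : 0 < y) :
    Tendsto (fun n : ℕ => ((n : ℝ) + 1) * (1 - laplace (paretoNNReal β) (paretoScale β n * y)))
      atTop (𝓝 (y ^ β)) := by
  have hc : 0 < β * levyConstant β := mul_pos hβ (levyConstant_pos hβ hβ1)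
  have hscale : Tendsto (fun n => paretoScale β n * y) atTop (𝓝[>] 0) := by
    refine tendsto_nhdsWithin_iff.2 ⟨?_, .of_forall fun n => mul_pos (paretoScale_pos hβ hβ1 n) hy⟩
    simpa only [zero_mul] using (tendsto_paretoScale hβ hβ1).mul_const y
  have hlimit := ((tendsto_rpow_mul_one_sub_laplace_paretoNNReal hβ hβ1).comp hscale).const_mul
    ((β * levyConstant β)⁻¹ * y ^ β)
  rw [mul_right_comm, inv_mul_cancel₀ hc.ne', one_mul] at hlimit
  refine hlimit.congr fun n => ?_
  have hs := paretoScale_pos hβ hβ1 n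
  have hn := mul_paretoScale_rpow hβ hβ1 n
  have hne : levyConstant β ≠ 0 := (levyConstant_pos hβ hβ1).ne'
  simp only [Function.comp_apply, Real.mul_rpow hs.le hy.le, Real.rpow_neg hs.le,
    Real.rpow_neg hy.le]
  field_simp
  linear_combination (-(1 - laplace (paretoNNReal β) (paretoScale β n * y))) * hn

theorem tendsto_laplace_paretoNNReal_pow (hβ : 0 < β) (hβ1 : β < 1) {y : ℝ} (hy : 0 ≤ y) :
    Tendsto (fun n => laplace (paretoNNReal β) (paretoScale β n * y) ^ (n + 1)) atTop
      (𝓝 (Real.exp (-y ^ β))) := by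
  have := isProbabilityMeasure_paretoNNReal hβ
  obtain rfl | hy := hy.eq_or_lt
  · simp [laplace, Real.zero_rpow hβ.ne']
  have hpow := Real.tendsto_one_add_pow_exp_of_tendsto
    (g := fun n : ℕ => -(1 - laplace (paretoNNReal β) (paretoScale β (n - 1) * y)))
    (t := -y ^ β) (by
      rw [← tendsto_add_atTop_iff_nat 1]
      refine (tendsto_mul_one_sub_laplace_paretoNNReal hβ hβ1 hy).neg.congr fun n => ?_
      simp only [Nat.add_sub_cancel, Nat.cast_add, Nat.cast_one, mul_neg])
  rw [← tendsto_add_atTop_iff_nat 1] at hpow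
  refine hpow.congr fun n => ?_
  simp only [Nat.add_sub_cancel, neg_sub, add_sub_cancel]

/-- The positive `β`-stable distribution, determined by its Laplace transform
`y ↦ exp (-y ^ β)`. -/
def IsPositiveStable (β : ℝ) (μ : Measure ℝ≥0) : Prop :=
  ∀ y, 0 ≤ y → laplace μ y = Real.exp (-y ^ β)

theorem isPositiveStable_one_dirac_one : IsPositiveStable 1 (Measure.dirac 1) := fun y _ => by
  simp [laplace]

theorem exists_isPositiveStable (hβ : 0 < β) (hβ1 : β ≤ 1) :
    ∃ μ : ProbabilityMeasure ℝ≥0, IsPositiveStable β μ := by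
  obtain rfl | hβ1 := hβ1.eq_or_lt
  · exact ⟨⟨Measure.dirac 1, inferInstance⟩, isPositiveStable_one_dirac_one⟩
  have := isProbabilityMeasure_paretoNNReal hβ
  choose μ hμ using fun n => exists_laplace_eq_pow (paretoNNReal β)
    ⟨paretoScale β n, (paretoScale_pos hβ hβ1 n).le⟩ (n + 1)
  refine exists_laplace_eq_of_tendsto (μ := μ) (M := fun y => y ^ β) ?_ (fun n y hy => ?_)
    fun y hy => ?_
  · simpa [Real.zero_rpow hβ.ne'] using
      (Real.continuousAt_rpow_const 0 β (.inr hβ.le)).tendsto.mono_left nhdsWithin_le_nhds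
  · exact hμ n y ▸ one_sub_laplace_paretoNNReal_pow_le hβ hβ1 n hy
  · exact (tendsto_laplace_paretoNNReal_pow hβ hβ1 hy).congr fun n => (hμ n y).symm

end PositiveStable

section PositiveStableMoments

variable {β : ℝ} {μ : Measure ℝ≥0} [IsProbabilityMeasure μ]

theorem measureReal_singleton_zero_le_laplace {y : ℝ} (hy : 0 ≤ y) :
    μ.real {0} ≤ laplace μ y := by
  have hmarkov := mul_meas_ge_le_integral_of_nonneg (μ := μ)
    (ae_of_all _ fun s => (Real.exp_pos (-(y * s))).le) (integrable_exp_neg_mul μ hy) 1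
  rw [one_mul] at hmarkov
  refine (measureReal_mono fun s hs => ?_).trans hmarkov
  simp [mem_singleton_iff.1 hs]

theorem IsPositiveStable.ae_pos (hμ : IsPositiveStable β μ) (hβ : 0 < β) :
    ∀ᵐ s : ℝ≥0 ∂μ, 0 < s := by
  have hexp : Tendsto (fun y : ℝ => Real.exp (-y ^ β)) atTop (𝓝 0) :=
    Real.tendsto_exp_neg_atTop_nhds_zero.comp (tendsto_rpow_atTop hβ)
  have hzero : μ.real {0} ≤ 0 := ge_of_tendsto hexp <| by
    filter_upwards [eventually_ge_atTop 0] with y hy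
    exact hμ y hy ▸ measureReal_singleton_zero_le_laplace hy
  have hnull : μ {0} = 0 := (measureReal_eq_zero_iff).1 (hzero.antisymm measureReal_nonneg)
  filter_upwards [compl_mem_ae_iff.2 hnull] with s hs
  exact pos_iff_ne_zero.2 hs

theorem lintegral_rpow_mul_exp_neg_mul {a s : ℝ} (ha : 0 < a) (hs : 0 < s) :
    ∫⁻ y in Ioi (0 : ℝ), ENNReal.ofReal (y ^ (a - 1) * Real.exp (-(y * s)))
      = ENNReal.ofReal (s ^ (-a) * Real.Gamma a) := by
  have hgamma := Real.integral_rpow_mul_exp_neg_mul_Ioi ha hs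
  simp_rw [mul_comm s, one_div, Real.inv_rpow hs.le, ← Real.rpow_neg hs.le] at hgamma
  have hpos : 0 < s ^ (-a) * Real.Gamma a := mul_pos (by positivity) (Real.Gamma_pos_of_pos ha)
  rw [← ofReal_integral_eq_lintegral_ofReal (.of_integral_ne_zero (hgamma ▸ hpos.ne')), hgamma]
  filter_upwards [ae_restrict_mem measurableSet_Ioi] with y hy
  have : (0 : ℝ) < y := hy
  positivity

theorem IsPositiveStable.integrable_rpow_neg (hμ : IsPositiveStable β μ) (hβ : 0 < β) {a : ℝ}
    (ha : 0 < a) : Integrable (fun s : ℝ≥0 => (s : ℝ) ^ (-a)) μ := by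
  have hfinite : ∫⁻ s : ℝ≥0, ENNReal.ofReal ((s : ℝ) ^ (-a) * Real.Gamma a) ∂μ < ∞ := by
    calc ∫⁻ s : ℝ≥0, ENNReal.ofReal ((s : ℝ) ^ (-a) * Real.Gamma a) ∂μ
        = ∫⁻ s : ℝ≥0, (∫⁻ y in Ioi (0 : ℝ),
            ENNReal.ofReal (y ^ (a - 1) * Real.exp (-(y * s)))) ∂μ :=
          lintegral_congr_ae ((hμ.ae_pos hβ).mono fun s hs =>
            (lintegral_rpow_mul_exp_neg_mul ha (mod_cast hs)).symm)
      _ = ∫⁻ y in Ioi (0 : ℝ), ∫⁻ s : ℝ≥0,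
            ENNReal.ofReal (y ^ (a - 1) * Real.exp (-(y * s))) ∂μ :=
          lintegral_lintegral_swap (by fun_prop)
      _ = ∫⁻ y in Ioi (0 : ℝ), ENNReal.ofReal (y ^ (a - 1) * Real.exp (-y ^ β)) := by
          refine setLIntegral_congr_fun measurableSet_Ioi fun y hy => ?_
          have hy : 0 < y := hy
          rw [← ofReal_integral_eq_lintegral_ofReal
            ((integrable_exp_neg_mul μ hy.le).const_mul _) (ae_of_all _ fun s => by positivity),
            integral_const_mul, ← laplace, hμ y hy.le]
      _ < ∞ := (integrableOn_rpow_mul_exp_neg_rpow (by linarith) hβ).lintegral_lt_top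
  have hGamma := (Real.Gamma_pos_of_pos ha).ne'
  refine (integrable_mul_const_iff hGamma.isUnit _).1
    ⟨Measurable.aestronglyMeasurable (by fun_prop), ?_⟩
  rw [hasFiniteIntegral_iff_ofReal (ae_of_all _ fun s => ?_)]
  · exact hfinite
  · have := Real.Gamma_pos_of_pos ha
    positivity

theorem IsPositiveStable.integrable_rpow (hμ : IsPositiveStable β μ) (hβ1 : β ≤ 1) {q : ℝ}
    (hq : 0 ≤ q) (hqβ : q < β) : Integrable (fun s : ℝ≥0 => (s : ℝ) ^ q) μ := by
  obtain rfl | hq := hq.eq_or_lt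
  · simp
  have hc := levyConstant_pos hq (hqβ.trans_le hβ1)
  have hfinite : ∫⁻ s : ℝ≥0, ENNReal.ofReal (levyConstant q * (s : ℝ) ^ q) ∂μ < ∞ := by
    calc ∫⁻ s : ℝ≥0, ENNReal.ofReal (levyConstant q * (s : ℝ) ^ q) ∂μ
        = ∫⁻ s : ℝ≥0, (∫⁻ u in Ioi (0 : ℝ),
            ENNReal.ofReal (u ^ (-(q + 1)) * (1 - Real.exp (-(u * s))))) ∂μ := by
          refine lintegral_congr fun s => ?_
          simp_rw [mul_comm _ (s : ℝ)]
          exact (lintegral_rpow_mul_one_sub_exp_neg_mul hq (hqβ.trans_le hβ1) s.coe_nonneg).symm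
      _ = ∫⁻ u in Ioi (0 : ℝ), ∫⁻ s : ℝ≥0,
            ENNReal.ofReal (u ^ (-(q + 1)) * (1 - Real.exp (-(u * s)))) ∂μ :=
          lintegral_lintegral_swap (by fun_prop)
      _ = ∫⁻ u in Ioi (0 : ℝ), ENNReal.ofReal (u ^ (-(q + 1)) * (1 - Real.exp (-u ^ β))) := by
          refine setLIntegral_congr_fun measurableSet_Ioi fun u hu => ?_
          have hu : 0 < u := hu
          rw [← ofReal_integral_eq_lintegral_ofReal
            ((integrable_one_sub_exp_neg_mul μ hu.le).const_mul _)
            (ae_of_all _ fun s => rpow_mul_one_sub_exp_neg_nonneg hu.le (by positivity) _),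
            integral_const_mul, ← one_sub_laplace μ hu.le, hμ u hu.le]
      _ < ∞ := (integrableOn_rpow_mul_one_sub_exp_neg_rpow hq hqβ).lintegral_lt_top
  refine (integrable_const_mul_iff hc.ne'.isUnit _).1 ⟨by fun_prop, ?_⟩
  rw [hasFiniteIntegral_iff_ofReal (ae_of_all _ fun s => by positivity)]
  exact hfinite

theorem IsPositiveStable.integrable_one_add_sqrt_rpow (hμ : IsPositiveStable β μ) (hβ1 : β ≤ 1)
    {p : ℝ} (hp : 0 ≤ p) (hpβ : p < 2 * β) :
    Integrable (fun s : ℝ≥0 => (1 + √(s : ℝ)) ^ p) μ := by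
  have hmoment := hμ.integrable_rpow hβ1 (q := p / 2) (by linarith) (by linarith)
  refine (((integrable_const (1 : ℝ)).add hmoment).const_mul (2 ^ p)).mono' (by fun_prop)
    (ae_of_all _ fun s => ?_)
  rw [Real.norm_of_nonneg (by positivity)]
  have hsqrt : √(s : ℝ) ^ p = (s : ℝ) ^ (p / 2) := by
    rw [Real.sqrt_eq_rpow, ← Real.rpow_mul s.coe_nonneg, one_div_mul_eq_div]
  calc (1 + √(s : ℝ)) ^ p ≤ (2 * max 1 √(s : ℝ)) ^ p := by
        gcongr
        linarith [le_max_left 1 √(s : ℝ), le_max_right 1 √(s : ℝ)]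
    _ = 2 ^ p * (max 1 √(s : ℝ)) ^ p := Real.mul_rpow zero_le_two (by positivity)
    _ ≤ 2 ^ p * (1 + (s : ℝ) ^ (p / 2)) := by
        gcongr
        rcases max_choice 1 √(s : ℝ) with h | h <;> rw [h]
        · rw [Real.one_rpow]
          exact le_add_of_nonneg_right (by positivity)
        · exact hsqrt ▸ le_add_of_nonneg_left zero_le_one

theorem IsPositiveStable.integrable_inv_sqrt_mul_one_add_sqrt_rpow (hμ : IsPositiveStable β μ)
    (hβ1 : β ≤ 1) {p : ℝ} (hp : 0 ≤ p) (hpβ : p < 2 * β) :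
    Integrable (fun s : ℝ≥0 => (√(s : ℝ))⁻¹ * (1 + √(s : ℝ)) ^ p) μ := by
  have hneg := hμ.integrable_rpow_neg (by linarith) (a := 1 / 2) (by norm_num)
  refine ((hneg.const_mul (2 ^ p)).add (hμ.integrable_one_add_sqrt_rpow hβ1 hp hpβ)).mono'
    (by fun_prop) (ae_of_all _ fun s => ?_)
  rw [Real.norm_of_nonneg (by positivity), Pi.add_apply, Real.rpow_neg s.coe_nonneg,
    ← Real.sqrt_eq_rpow]
  obtain hs | hs := le_total √(s : ℝ) 1
  · calc (√(s : ℝ))⁻¹ * (1 + √(s : ℝ)) ^ p ≤ (√(s : ℝ))⁻¹ * 2 ^ p := by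
          gcongr
          linarith
      _ ≤ 2 ^ p * (√(s : ℝ))⁻¹ + (1 + √(s : ℝ)) ^ p := by
          rw [mul_comm]
          exact le_add_of_nonneg_right (by positivity)
  · calc (√(s : ℝ))⁻¹ * (1 + √(s : ℝ)) ^ p ≤ (1 + √(s : ℝ)) ^ p :=
          mul_le_of_le_one_left (by positivity) (inv_le_one_of_one_le₀ hs)
      _ ≤ 2 ^ p * (√(s : ℝ))⁻¹ + (1 + √(s : ℝ)) ^ p := le_add_of_nonneg_left (by positivity)

end PositiveStableMoments

section GaussianMixture

variable {V : Type*} [NormedAddCommGroup V] [InnerProductSpace ℝ V] [FiniteDimensional ℝ V]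
  [MeasurableSpace V] [BorelSpace V]

variable (V) in
/-- The law of `√(2 S) • Z` for independent `S ∼ μ` and standard Gaussian `Z`. The factor `2` turns
the Laplace transform of `μ` at `‖u‖ ^ 2` into the characteristic function at `u`. -/
noncomputable def gaussianMixture (μ : Measure ℝ≥0) : Measure V :=
  (μ.prod (stdGaussian V)).map fun x => (√2 * √(x.1 : ℝ)) • x.2

variable {μ : Measure ℝ≥0}

instance [IsProbabilityMeasure μ] : IsProbabilityMeasure (gaussianMixture V μ) :=
  Measure.isProbabilityMeasure_map (by fun_prop)

theorem integrable_gaussianMixture_iff {G : Type*} [NormedAddCommGroup G] {g : V → G}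
    (hg : AEStronglyMeasurable g (gaussianMixture V μ)) :
    Integrable g (gaussianMixture V μ) ↔
      Integrable (fun x : ℝ≥0 × V => g ((√2 * √(x.1 : ℝ)) • x.2)) (μ.prod (stdGaussian V)) :=
  integrable_map_measure hg (by fun_prop)

theorem integrable_one_add_norm_rpow_gaussianMixture {p : ℝ} (hp : 0 ≤ p)
    (hμ : Integrable (fun s : ℝ≥0 => (1 + √(s : ℝ)) ^ p) μ) :
    Integrable (fun y => (1 + ‖y‖) ^ p) (gaussianMixture V μ) := by
  refine (integrable_gaussianMixture_iff (by fun_prop)).2 ?_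
  refine ((hμ.mul_prod (integrable_one_add_norm_rpow_stdGaussian (V := V) hp)).const_mul
    ((1 + √2) ^ p)).mono' (by fun_prop) (ae_of_all _ fun ⟨s, z⟩ => ?_)
  rw [Real.norm_of_nonneg (by positivity)]
  calc (1 + ‖(√2 * √(s : ℝ)) • z‖) ^ p ≤ (1 + |√2|) ^ p * (1 + ‖√(s : ℝ) • z‖) ^ p := by
        rw [mul_smul]
        exact one_add_norm_smul_rpow_le hp _ _
    _ ≤ (1 + √2) ^ p * ((1 + √(s : ℝ)) ^ p * (1 + ‖z‖) ^ p) := by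
        rw [abs_of_nonneg (by positivity)]
        gcongr
        simpa only [abs_of_nonneg (Real.sqrt_nonneg s)] using
          one_add_norm_smul_rpow_le hp √(s : ℝ) z

variable [IsProbabilityMeasure μ]

theorem integral_gaussianMixture {G : Type*} [NormedAddCommGroup G] [NormedSpace ℝ G] {g : V → G}
    (hg : Integrable g (gaussianMixture V μ)) :
    ∫ y, g y ∂gaussianMixture V μ
      = ∫ s : ℝ≥0, ∫ z, g ((√2 * √(s : ℝ)) • z) ∂stdGaussian V ∂μ := by
  have hprod := (integrable_gaussianMixture_iff hg.1).1 hg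
  rw [gaussianMixture, integral_map (by fun_prop) hg.1, integral_prod _ hprod]

theorem charFun_gaussianMixture (u : V) :
    charFun (gaussianMixture V μ) u = (laplace μ (‖u‖ ^ 2) : ℝ) := by
  have hconditional (s : ℝ≥0) :
      ∫ z, Complex.exp (⟪(√2 * √(s : ℝ)) • z, u⟫ * Complex.I) ∂stdGaussian V
        = (Real.exp (-(‖u‖ ^ 2 * s)) : ℝ) := by
    have hchar := charFun_stdGaussian ((√2 * √(s : ℝ)) • u)
    rw [charFun_apply] at hchar
    simp_rw [real_inner_smul_right, ← real_inner_smul_left] at hchar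
    rw [hchar, norm_smul, Real.norm_of_nonneg (by positivity)]
    norm_cast
    rw [mul_pow, mul_pow, Real.sq_sqrt zero_le_two, Real.sq_sqrt s.coe_nonneg]
    ring_nf
  rw [charFun_apply, integral_gaussianMixture, laplace, ← integral_complex_ofReal]
  · exact integral_congr_ae (ae_of_all _ hconditional)
  · refine .of_bound (by fun_prop) 1 (ae_of_all _ fun y => ?_)
    rw [Complex.norm_exp_ofReal_mul_I]

theorem abs_integral_gaussianMixture_affine_sub_le {p : ℝ} (hp : 0 ≤ p)
    (hpos : ∀ᵐ s : ℝ≥0 ∂μ, 0 < s) (hμ : Integrable (fun s : ℝ≥0 => (1 + √(s : ℝ)) ^ p) μ)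
    (hμ_inv : Integrable (fun s : ℝ≥0 => (√(s : ℝ))⁻¹ * (1 + √(s : ℝ)) ^ p) μ) {h : V → ℝ}
    (hh : Measurable h) {c a a' : V} (hbound : ∀ y, |h y| ≤ (1 + ‖y - c‖) ^ p) {R : ℝ}
    (ha : ‖a - c‖ ≤ R) (ha' : ‖a' - c‖ ≤ R) {σ : ℝ} (hσ : σ ≠ 0) :
    |∫ y, h (a + σ • y) ∂gaussianMixture V μ - ∫ y, h (a' + σ • y) ∂gaussianMixture V μ|
      ≤ (1 + R) ^ p * ‖a - a'‖ * (∫ z, (1 + ‖z‖) ^ (p + 1) ∂stdGaussian V)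
        * (|σ * √2|⁻¹ * (1 + |σ * √2|) ^ p)
        * ∫ s : ℝ≥0, (√(s : ℝ))⁻¹ * (1 + √(s : ℝ)) ^ p ∂μ := by
  have hR : 0 ≤ R := (norm_nonneg _).trans ha
  have hint (b : V) : Integrable (fun y => h (b + σ • y)) (gaussianMixture V μ) :=
    integrable_comp_add_smul hp (integrable_one_add_norm_rpow_gaussianMixture hp hμ) hh hbound b σ
  have hint_left (b : V) :
      Integrable (fun s : ℝ≥0 => ∫ z, h (b + σ • (√2 * √(s : ℝ)) • z) ∂stdGaussian V) μ :=
    ((integrable_gaussianMixture_iff (hint b).1).1 (hint b)).integral_prod_left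
  rw [integral_gaussianMixture (hint a), integral_gaussianMixture (hint a'),
    ← integral_sub (hint_left a) (hint_left a'), ← integral_const_mul, ← Real.norm_eq_abs]
  refine norm_integral_le_of_norm_le (hμ_inv.const_mul _) (hpos.mono fun s hs => ?_)
  have ht : σ * √2 * √(s : ℝ) ≠ 0 := by positivity
  have hscale : (1 + |σ * √2 * √(s : ℝ)|) ^ p ≤ (1 + |σ * √2|) ^ p * (1 + √(s : ℝ)) ^ p := by
    simpa only [smul_eq_mul, Real.norm_eq_abs, abs_of_nonneg (Real.sqrt_nonneg (s : ℝ))] using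
      one_add_norm_smul_rpow_le hp (σ * √2) √(s : ℝ)
  simp only [smul_smul, ← mul_assoc σ]
  calc _ ≤ (1 + R) ^ p * (1 + |σ * √2 * √(s : ℝ)|) ^ p
          * (∫ z, (1 + ‖z‖) ^ (p + 1) ∂stdGaussian V)
          * (|σ * √2 * √(s : ℝ)|⁻¹ * ‖a - a'‖) :=
        abs_integral_stdGaussian_affine_sub_le hp hh hbound ha ha' ht
    _ ≤ (1 + R) ^ p * ((1 + |σ * √2|) ^ p * (1 + √(s : ℝ)) ^ p)
          * (∫ z, (1 + ‖z‖) ^ (p + 1) ∂stdGaussian V)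
          * (|σ * √2 * √(s : ℝ)|⁻¹ * ‖a - a'‖) := by gcongr
    _ = _ := by
        rw [abs_mul (σ * √2), abs_of_nonneg (Real.sqrt_nonneg (s : ℝ)), mul_inv]
        ring

end GaussianMixture

section RotInvStable

variable {d : ℕ} {α p : ℝ} {ν : Measure (Param d)} [IsFiniteMeasure ν]

theorem IsRotInvStable.eq_gaussianMixture (hν : IsRotInvStable α ν) {μ : Measure ℝ≥0}
    [IsProbabilityMeasure μ] (hμ : IsPositiveStable (α / 2) μ) :
    ν = gaussianMixture (Param d) μ := by
  refine Measure.ext_of_charFun (funext fun u => ?_)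
  rw [hν u, charFun_gaussianMixture, hμ _ (sq_nonneg _), ← Real.rpow_natCast,
    ← Real.rpow_mul (norm_nonneg u), Nat.cast_ofNat, mul_div_cancel₀ α two_ne_zero]

theorem IsRotInvStable.integrable_one_add_norm_rpow (hν : IsRotInvStable α ν)
    (hα : α ∈ Ioc 0 2) (hp : p ∈ Ico 0 α) : Integrable (fun y => (1 + ‖y‖) ^ p) ν := by
  obtain ⟨μ, hμ⟩ := exists_isPositiveStable (half_pos hα.1) (by linarith [hα.2])
  rw [hν.eq_gaussianMixture hμ]
  exact integrable_one_add_norm_rpow_gaussianMixture hp.1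
    (hμ.integrable_one_add_sqrt_rpow (by linarith [hα.2]) hp.1 (by linarith [hp.2]))

theorem IsRotInvStable.exists_abs_integral_affine_sub_le (hν : IsRotInvStable α ν)
    (hα : α ∈ Ioc 0 2) (hp : p ∈ Ico 0 α) {σ : ℝ} (hσ : σ ≠ 0) :
    ∃ M, 0 ≤ M ∧ ∀ (h : Param d → ℝ) (c a a' : Param d) (R : ℝ), Measurable h →
      (∀ y, |h y| ≤ (1 + ‖y - c‖) ^ p) → ‖a - c‖ ≤ R → ‖a' - c‖ ≤ R →
        |∫ y, h (a + σ • y) ∂ν - ∫ y, h (a' + σ • y) ∂ν| ≤ (1 + R) ^ p * ‖a - a'‖ * M := by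
  have hα2 : α / 2 ≤ 1 := by linarith [hα.2]
  have hpα : p < 2 * (α / 2) := by linarith [hp.2]
  obtain ⟨μ, hμ⟩ := exists_isPositiveStable (half_pos hα.1) hα2
  refine ⟨(∫ z, (1 + ‖z‖) ^ (p + 1) ∂stdGaussian (Param d))
    * (|σ * √2|⁻¹ * (1 + |σ * √2|) ^ p)
    * ∫ s : ℝ≥0, (√(s : ℝ))⁻¹ * (1 + √(s : ℝ)) ^ p ∂(μ : Measure ℝ≥0), by positivity, ?_⟩
  intro h c a a' R hh hbound ha ha'
  rw [hν.eq_gaussianMixture hμ, ← mul_assoc, ← mul_assoc]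
  exact abs_integral_gaussianMixture_affine_sub_le hp.1 (hμ.ae_pos (half_pos hα.1))
    (hμ.integrable_one_add_sqrt_rpow hα2 hp.1 hpα)
    (hμ.integrable_inv_sqrt_mul_one_add_sqrt_rpow hα2 hp.1 hpα) hh hbound ha ha' hσ

end RotInvStable

section Risk

variable {d n : ℕ} {E : Type*} [NormedAddCommGroup E] {𝒳 : Set E} {f : Param d → E → ℝ}
  {K₁ K₂ B m K D : ℝ} {X X' : Fin n → E}

theorem gradient_empRisk (hf : PseudoLipschitzGrad 𝒳 f K₁ K₂) (hX : ∀ i, X i ∈ 𝒳)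
    (θ : Param d) :
    gradient (empRisk f X) θ = (n : ℝ)⁻¹ • ∑ i, gradient (fun ϑ => f ϑ (X i)) θ := by
  refine HasGradientAt.gradient (hasGradientAt_iff_hasFDerivAt.2 ?_)
  rw [map_smul, map_sum]
  exact (HasFDerivAt.fun_sum fun i _ => hasGradientAt_iff_hasFDerivAt.1
    (hf.differentiable _ (hX i) θ).hasGradientAt).const_mul (n : ℝ)⁻¹

theorem norm_gradient_empRisk_sub_le (hn : 0 < n) (hf : PseudoLipschitzGrad 𝒳 f K₁ K₂)
    (hX : ∀ i, X i ∈ 𝒳) (θ θ' : Param d) :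
    ‖gradient (empRisk f X) θ - gradient (empRisk f X) θ'‖ ≤ K₁ * ‖θ - θ'‖ := by
  rw [gradient_empRisk hf hX, gradient_empRisk hf hX, ← smul_sub, ← Finset.sum_sub_distrib,
    norm_smul, Real.norm_of_nonneg (by positivity), inv_mul_le_iff₀ (by positivity)]
  have hterm : ∀ i ∈ Finset.univ, ‖gradient (fun ϑ => f ϑ (X i)) θ
      - gradient (fun ϑ => f ϑ (X i)) θ'‖ ≤ K₁ * ‖θ - θ'‖ := fun i _ => by
    simpa only [sub_self, norm_zero, mul_zero, zero_mul, add_zero] using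
      hf.bound _ (hX i) _ (hX i) θ θ'
  simpa only [Finset.card_univ, Fintype.card_fin, nsmul_eq_mul] using
    (norm_sum_le _ _).trans (Finset.sum_le_card_nsmul _ _ _ hterm)

theorem norm_gradient_empRisk_le_of_eq_zero (hn : 0 < n) (hf : PseudoLipschitzGrad 𝒳 f K₁ K₂)
    (hX : ∀ i, X i ∈ 𝒳) {θs : Param d} (hθs : gradient (empRisk f X) θs = 0) (θ : Param d) :
    ‖gradient (empRisk f X) θ‖ ≤ |K₁| * ‖θ - θs‖ := by
  have hlipschitz := norm_gradient_empRisk_sub_le hn hf hX θ θs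
  rw [hθs, sub_zero] at hlipschitz
  exact hlipschitz.trans (mul_le_mul_of_nonneg_right (le_abs_self K₁) (norm_nonneg _))

theorem norm_gradient_empRisk_sub_le_of_neighboring (hf : PseudoLipschitzGrad 𝒳 f K₁ K₂)
    (hD : ∀ x ∈ 𝒳, ∀ x' ∈ 𝒳, ‖x - x'‖ ≤ D) (hX : ∀ i, X i ∈ 𝒳) (hX' : ∀ i, X' i ∈ 𝒳)
    (hN : Neighboring X X') (θ : Param d) :
    ‖gradient (empRisk f X) θ - gradient (empRisk f X') θ‖
      ≤ (n : ℝ)⁻¹ * (|K₂| * |D|) * (2 * ‖θ‖ + 1) := by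
  obtain ⟨i, hi⟩ := hN
  rw [gradient_empRisk hf hX, gradient_empRisk hf hX', ← smul_sub, ← Finset.sum_sub_distrib,
    Finset.sum_eq_single i (fun j _ hj => by rw [hi j hj, sub_self]) (by simp),
    norm_smul, Real.norm_of_nonneg (by positivity), mul_assoc (n : ℝ)⁻¹]
  gcongr
  calc ‖gradient (fun ϑ => f ϑ (X i)) θ - gradient (fun ϑ => f ϑ (X' i)) θ‖
      ≤ K₂ * ‖X i - X' i‖ * (2 * ‖θ‖ + 1) := by
        simpa only [sub_self, norm_zero, mul_zero, zero_add, two_mul] using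
          hf.bound _ (hX i) _ (hX' i) θ θ
    _ ≤ |K₂| * |D| * (2 * ‖θ‖ + 1) := by
        gcongr
        · exact le_abs_self K₂
        · exact (hD _ (hX i) _ (hX' i)).trans (le_abs_self D)

theorem mul_norm_sq_le_of_gradient_empRisk_eq_zero (hn : 0 < n)
    (hf : PseudoLipschitzGrad 𝒳 f K₁ K₂) (hd : Dissipative 𝒳 f B m K) (hX : ∀ i, X i ∈ 𝒳)
    {θ : Param d} (hθ : gradient (empRisk f X) θ = 0) : m * ‖θ‖ ^ 2 - K ≤ B * ‖θ‖ := by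
  have hsum : ∑ i, gradient (fun ϑ => f ϑ (X i)) θ = 0 := by
    rw [gradient_empRisk hf hX, smul_eq_zero] at hθ
    exact hθ.resolve_left (by positivity)
  have hterm (i : Fin n) :
      m * ‖θ‖ ^ 2 - K ≤ ⟪gradient (fun ϑ => f ϑ (X i)) θ, θ⟫ + B * ‖θ‖ := by
    have hdissip := hd.dissip _ (hX i) θ 0
    rw [sub_zero, inner_sub_left] at hdissip
    have hzero : -⟪gradient (fun ϑ => f ϑ (X i)) 0, θ⟫ ≤ B * ‖θ‖ :=
      (neg_le_abs _).trans ((abs_real_inner_le_norm _ _).trans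
        (mul_le_mul_of_nonneg_right (hd.grad_zero _ (hX i)) (norm_nonneg θ)))
    linarith
  have htotal := Finset.sum_le_sum fun i (_ : i ∈ Finset.univ) => hterm i
  rw [Finset.sum_add_distrib, ← sum_inner, hsum, inner_zero_left, zero_add] at htotal
  simp only [Finset.sum_const, Finset.card_univ, Fintype.card_fin, nsmul_eq_mul] at htotal
  exact le_of_mul_le_mul_left htotal (by positivity)

theorem norm_le_of_gradient_empRisk_eq_zero (hn : 0 < n) (hf : PseudoLipschitzGrad 𝒳 f K₁ K₂)
    (hd : Dissipative 𝒳 f B m K) (hm : 0 < m) (hX : ∀ i, X i ∈ 𝒳) {θ : Param d}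
    (hθ : gradient (empRisk f X) θ = 0) : ‖θ‖ ≤ 1 + (|B| + |K|) / m := by
  have hquadratic := mul_norm_sq_le_of_gradient_empRisk_eq_zero hn hf hd hX hθ
  obtain hθ1 | hθ1 := le_total ‖θ‖ 1
  · exact hθ1.trans (le_add_of_nonneg_right (by positivity))
  · refine le_add_of_nonneg_of_le zero_le_one ((le_div_iff₀ hm).2 ?_)
    refine le_of_mul_le_mul_left ?_ (zero_lt_one.trans_le hθ1)
    calc ‖θ‖ * (‖θ‖ * m) ≤ B * ‖θ‖ + K := by linarith
      _ ≤ |B| * ‖θ‖ + |K| * ‖θ‖ := by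
          gcongr
          · exact le_abs_self B
          · exact (le_abs_self K).trans (le_mul_of_one_le_right (abs_nonneg K) hθ1)
      _ = ‖θ‖ * (|B| + |K|) := by ring

end Risk

section Lyapunov

variable {d : ℕ} {q : ℝ}

theorem continuous_lyap (q : ℝ) (c : Param d) : Continuous (lyap q c) :=
  Continuous.rpow_const (by fun_prop) fun θ => .inl (by positivity)

theorem lyap_eq_sqrt_rpow (q : ℝ) (c θ : Param d) :
    lyap q c θ = √(1 + ‖θ - c‖ ^ 2) ^ q := by
  rw [lyap, Real.sqrt_eq_rpow, ← Real.rpow_mul (by positivity), one_div_mul_eq_div]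

theorem lyap_nonneg (q : ℝ) (c θ : Param d) : 0 ≤ lyap q c θ :=
  Real.rpow_nonneg (by positivity) _

theorem lyap_le_one_add_norm_sub_rpow (hq : 0 ≤ q) (c θ : Param d) :
    lyap q c θ ≤ (1 + ‖θ - c‖) ^ q := by
  rw [lyap_eq_sqrt_rpow]
  gcongr
  refine (Real.sqrt_le_left (by positivity)).2 ?_
  linarith [add_sq 1 ‖θ - c‖, norm_nonneg (θ - c)]

theorem abs_lyap_le (hq : 0 ≤ q) (c θ : Param d) : |lyap q c θ| ≤ (1 + ‖θ - c‖) ^ q := by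
  rw [abs_of_nonneg (lyap_nonneg q c θ)]
  exact lyap_le_one_add_norm_sub_rpow hq c θ

theorem one_add_rpow_mul_le_lyap {p κ R : ℝ} (hp : 0 ≤ p) (hκ : 1 ≤ κ) (hR : 0 ≤ R)
    (c θ : Param d) :
    (1 + κ * (‖θ - c‖ + 2 * R)) ^ p * (2 * (‖θ - c‖ + R) + 1)
      ≤ (κ * (2 + 2 * R)) ^ p * (3 + 2 * R) * lyap (1 + p) c θ := by
  have : 0 < κ := one_pos.trans_le hκ
  rw [lyap_eq_sqrt_rpow]
  set W := √(1 + ‖θ - c‖ ^ 2)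
  have hW1 : 1 ≤ W := Real.one_le_sqrt.2 (le_add_of_nonneg_right (sq_nonneg _))
  have hxW : ‖θ - c‖ ≤ W := Real.le_sqrt_of_sq_le (by linarith)
  have hW0 : 0 < W := one_pos.trans_le hW1
  have hRW : R ≤ R * W := le_mul_of_one_le_right hR hW1
  calc (1 + κ * (‖θ - c‖ + 2 * R)) ^ p * (2 * (‖θ - c‖ + R) + 1)
      ≤ (κ * (1 + (‖θ - c‖ + 2 * R))) ^ p * (2 * (‖θ - c‖ + R) + 1) := by
        gcongr
        linarith
    _ ≤ (κ * ((2 + 2 * R) * W)) ^ p * ((3 + 2 * R) * W) := by gcongr <;> linarith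
    _ = (κ * (2 + 2 * R)) ^ p * (3 + 2 * R) * W ^ (1 + p) := by
        rw [← mul_assoc κ, Real.mul_rpow (by positivity) hW0.le, Real.rpow_one_add' hW0.le]
        · ring
        · positivity

end Lyapunov

section Kernel

variable {d : ℕ} {p η σ : ℝ} {ν : Measure (Param d)}

theorem measurable_gdStep_apply (η σ : ℝ) (F : Param d → ℝ) (θ : Param d) :
    Measurable (gdStep η σ F θ) :=
  (measurable_gdStep η σ F).comp measurable_prodMk_left

theorem integrable_lyap_gdKernel [SFinite ν] (hp : 0 ≤ p)
    (hν : Integrable (fun z => (1 + ‖z‖) ^ p) ν) (c : Param d) (F : Param d → ℝ) (θ : Param d) :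
    Integrable (lyap p c) (gdKernel η σ F ν θ) :=
  (integrable_map_measure (continuous_lyap p c).aestronglyMeasurable
    (measurable_gdStep_apply η σ F θ).aemeasurable).2
      (integrable_comp_add_smul hp hν (continuous_lyap p c).measurable (abs_lyap_le hp c)
        (θ - η • gradient F θ) σ)

theorem integral_gdKernel [SFinite ν] {h : Param d → ℝ} (hh : Measurable h) (F : Param d → ℝ)
    (θ : Param d) :
    ∫ y, h y ∂gdKernel η σ F ν θ = ∫ z, h (θ - η • gradient F θ + σ • z) ∂ν :=
  integral_map (measurable_gdStep_apply η σ F θ).aemeasurable hh.aestronglyMeasurable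

theorem norm_sub_smul_gradient_sub_le {F : Param d → ℝ} {θ θs : Param d} {L : ℝ} (hL : 0 ≤ L)
    (hF : ‖gradient F θ‖ ≤ L * ‖θ - θs‖) (c : Param d) :
    ‖θ - η • gradient F θ - c‖ ≤ (1 + |η| * L) * (‖θ - θs‖ + ‖θs - c‖) :=
  calc ‖θ - η • gradient F θ - c‖ ≤ ‖θ - c‖ + |η| * ‖gradient F θ‖ := by
        rw [sub_right_comm, ← Real.norm_eq_abs, ← norm_smul]
        exact norm_sub_le _ _
    _ ≤ (‖θ - θs‖ + ‖θs - c‖) + |η| * (L * (‖θ - θs‖ + ‖θs - c‖)) := by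
        gcongr
        · exact norm_sub_le_norm_sub_add_norm_sub θ θs c
        · exact hF.trans (by gcongr; exact le_add_of_nonneg_right (norm_nonneg _))
    _ = (1 + |η| * L) * (‖θ - θs‖ + ‖θs - c‖) := by ring

variable {α : ℝ} [IsFiniteMeasure ν]

theorem IsRotInvStable.exists_vNorm_lyap_gdKernel_le (hν : IsRotInvStable α ν)
    (hα : α ∈ Ioc 0 2) (hp : p ∈ Ico 0 α) (hσ : σ ≠ 0) :
    ∃ M, 0 ≤ M ∧ ∀ (η : ℝ) (F F' : Param d → ℝ) (c θ : Param d) (R : ℝ),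
      ‖θ - η • gradient F θ - c‖ ≤ R → ‖θ - η • gradient F' θ - c‖ ≤ R →
        vNorm (lyap p c) (gdKernel η σ F ν θ) (gdKernel η σ F' ν θ)
          ≤ ENNReal.ofReal ((1 + R) ^ p * (|η| * ‖gradient F θ - gradient F' θ‖) * M) := by
  obtain ⟨M, hM, hshift⟩ := hν.exists_abs_integral_affine_sub_le hα hp hσ
  refine ⟨M, hM, fun η F F' c θ R hF hF' => iSup₂_le fun g hg => ENNReal.ofReal_le_ofReal ?_⟩
  rw [integral_gdKernel hg.1, integral_gdKernel hg.1]
  refine (hshift g c _ _ R hg.1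
    (fun y => (hg.2 y).trans (lyap_le_one_add_norm_sub_rpow hp.1 c y)) hF hF').trans_eq ?_
  rw [sub_sub_sub_cancel_left, ← smul_sub, norm_smul, Real.norm_eq_abs, norm_sub_rev]

theorem IsRotInvStable.exists_kernelDist_gdKernel_le (hν : IsRotInvStable α ν)
    (hα : α ∈ Ioc 0 2) (hp : p ∈ Ico 0 α) (η : ℝ) (hσ : σ ≠ 0) {L R : ℝ} (hL : 0 ≤ L)
    (hR : 0 ≤ R) :
    ∃ C, 0 ≤ C ∧ ∀ (F F' : Param d → ℝ) (θs θs' : Param d) (ε : ℝ), ‖θs‖ ≤ R → ‖θs'‖ ≤ R →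
      (∀ θ, ‖gradient F θ‖ ≤ L * ‖θ - θs‖) → (∀ θ, ‖gradient F' θ‖ ≤ L * ‖θ - θs'‖) →
      (∀ θ, ‖gradient F θ - gradient F' θ‖ ≤ ε * (2 * ‖θ‖ + 1)) →
        kernelDist (lyap p θs) (lyap (1 + p) θs') (gdKernel η σ F ν) (gdKernel η σ F' ν)
          ≤ ENNReal.ofReal (C * ε) := by
  obtain ⟨M, hM, hvNorm⟩ := hν.exists_vNorm_lyap_gdKernel_le hα hp hσ
  set κ := 1 + |η| * L
  have hκ : 1 ≤ κ := le_add_of_nonneg_right (by positivity)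
  refine ⟨(κ * (2 + 2 * R)) ^ p * (3 + 2 * R) * (|η| * M), by positivity,
    fun F F' θs θs' ε hθs hθs' hF hF' hFF' => iSup_le fun θ => ENNReal.div_le_of_le_mul ?_⟩
  have hε : 0 ≤ ε := nonneg_of_mul_nonneg_left ((norm_nonneg _).trans (hFF' 0)) (by positivity)
  have hcenters : ‖θs' - θs‖ ≤ 2 * R := by linarith [norm_sub_le θs' θs]
  have hnorm : ‖θ‖ ≤ ‖θ - θs'‖ + R := by linarith [norm_le_norm_sub_add θ θs']
  have hstep : ‖θ - η • gradient F θ - θs‖ ≤ κ * (‖θ - θs'‖ + 2 * R) :=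
    (norm_sub_smul_gradient_sub_le hL (hF θ) θs).trans (by
      rw [sub_self θs, norm_zero, add_zero]
      gcongr
      linarith [norm_sub_le_norm_sub_add_norm_sub θ θs' θs])
  have hstep' : ‖θ - η • gradient F' θ - θs‖ ≤ κ * (‖θ - θs'‖ + 2 * R) :=
    (norm_sub_smul_gradient_sub_le hL (hF' θ) θs).trans (by gcongr)
  refine (hvNorm η F F' θs θ _ hstep hstep').trans ?_
  rw [← ENNReal.ofReal_mul (by positivity)]
  refine ENNReal.ofReal_le_ofReal ?_
  calc (1 + κ * (‖θ - θs'‖ + 2 * R)) ^ p * (|η| * ‖gradient F θ - gradient F' θ‖) * M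
      ≤ (1 + κ * (‖θ - θs'‖ + 2 * R)) ^ p * (|η| * (ε * (2 * (‖θ - θs'‖ + R) + 1))) * M := by
        gcongr
        exact (hFF' θ).trans (by gcongr)
    _ = (1 + κ * (‖θ - θs'‖ + 2 * R)) ^ p * (2 * (‖θ - θs'‖ + R) + 1) * (|η| * M * ε) := by
        ring
    _ ≤ (κ * (2 + 2 * R)) ^ p * (3 + 2 * R) * lyap (1 + p) θs' θ * (|η| * M * ε) :=
        mul_le_mul_of_nonneg_right (one_add_rpow_mul_le_lyap hp.1 hκ hR θs' θ) (by positivity)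
    _ = (κ * (2 + 2 * R)) ^ p * (3 + 2 * R) * (|η| * M) * ε * lyap (1 + p) θs' θ := by ring

end Kernel

end NoisyGD

theorem mainTheorem3_general {d : ℕ} {α p η σ K₁ K₂ B m K D : ℝ}
    (hα : α ∈ Set.Ioc (0 : ℝ) 2) (hp : p ∈ Set.Ico 0 α) (hσ : σ ≠ 0) (hm : 0 < m)
    (ν : Measure (NoisyGD.Param d)) [IsProbabilityMeasure ν]
    (hν : NoisyGD.IsRotInvStable α ν) :
    ∃ C : ℝ, 0 < C ∧
      ∀ (E : Type*) [NormedAddCommGroup E] (𝒳 : Set E)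
        (_ : ∀ x ∈ 𝒳, ∀ x' ∈ 𝒳, ‖x - x'‖ ≤ D)
        (f : NoisyGD.Param d → E → ℝ)
        (_ : NoisyGD.PseudoLipschitzGrad 𝒳 f K₁ K₂)
        (_ : NoisyGD.Dissipative 𝒳 f B m K)
        (n : ℕ) (_ : 0 < n) (X X' : Fin n → E)
        (_ : ∀ i, X i ∈ 𝒳) (_ : ∀ i, X' i ∈ 𝒳) (_ : NoisyGD.Neighboring X X')
        (θs θs' : NoisyGD.Param d)
        (_ : gradient (NoisyGD.empRisk f X) θs = 0)
        (_ : gradient (NoisyGD.empRisk f X') θs' = 0),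
        (∀ θ,
          Integrable (NoisyGD.lyap p θs) (NoisyGD.gdKernel η σ (NoisyGD.empRisk f X) ν θ) ∧
          Integrable (NoisyGD.lyap p θs) (NoisyGD.gdKernel η σ (NoisyGD.empRisk f X') ν θ)) ∧
        NoisyGD.kernelDist (NoisyGD.lyap p θs) (NoisyGD.lyap (1 + p) θs')
            (NoisyGD.gdKernel η σ (NoisyGD.empRisk f X) ν)
            (NoisyGD.gdKernel η σ (NoisyGD.empRisk f X') ν)
          ≤ ENNReal.ofReal (C / n) := by
  obtain ⟨C, hC, hdist⟩ := hν.exists_kernelDist_gdKernel_le hα hp η hσ (abs_nonneg K₁)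
    (R := 1 + (|B| + |K|) / m) (by positivity)
  have hmoment := hν.integrable_one_add_norm_rpow hα hp
  refine ⟨C * (|K₂| * |D|) + 1, by positivity, ?_⟩
  intro E _ 𝒳 hD f hf hd n hn X X' hX hX' hN θs θs' hθs hθs'
  have hbound := hdist _ _ θs θs' ((n : ℝ)⁻¹ * (|K₂| * |D|))
    (NoisyGD.norm_le_of_gradient_empRisk_eq_zero hn hf hd hm hX hθs)
    (NoisyGD.norm_le_of_gradient_empRisk_eq_zero hn hf hd hm hX' hθs')
    (NoisyGD.norm_gradient_empRisk_le_of_eq_zero hn hf hX hθs)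
    (NoisyGD.norm_gradient_empRisk_le_of_eq_zero hn hf hX' hθs')
    (NoisyGD.norm_gradient_empRisk_sub_le_of_neighboring hf hD hX hX' hN)
  refine ⟨fun θ => ⟨NoisyGD.integrable_lyap_gdKernel hp.1 hmoment θs _ θ,
    NoisyGD.integrable_lyap_gdKernel hp.1 hmoment θs _ θ⟩, hbound.trans ?_⟩
  gcongr
  rw [mul_left_comm, div_eq_inv_mul]
  gcongr
  exact le_add_of_nonneg_right zero_le_one

theorem mainTheorem3 {d : ℕ} {α p η σ K₁ K₂ B m K D : ℝ}
    (hα : α ∈ Set.Ioo (1 : ℝ) 2) (hp : p ∈ Set.Ioo 0 (min (1 / 2) (α - 1)))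
    (hη : 0 < η) (hσ : 0 < σ) (hK₁ : 0 < K₁) (hK₂ : 0 < K₂)
    (hB : 0 < B) (hm : 0 < m) (hK : 0 < K)
    (ν : Measure (NoisyGD.Param d)) [IsProbabilityMeasure ν]
    (hν : NoisyGD.IsRotInvStable α ν) :
    ∃ C : ℝ, 0 < C ∧
      ∀ (E : Type*) [NormedAddCommGroup E] (𝒳 : Set E)
        (_ : ∀ x ∈ 𝒳, ∀ x' ∈ 𝒳, ‖x - x'‖ ≤ D)
        (f : NoisyGD.Param d → E → ℝ)
        (_ : NoisyGD.PseudoLipschitzGrad 𝒳 f K₁ K₂)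
        (_ : NoisyGD.Dissipative 𝒳 f B m K)
        (n : ℕ) (_ : 0 < n) (X X' : Fin n → E)
        (_ : ∀ i, X i ∈ 𝒳) (_ : ∀ i, X' i ∈ 𝒳) (_ : NoisyGD.Neighboring X X')
        (θs θs' : NoisyGD.Param d)
        (_ : gradient (NoisyGD.empRisk f X) θs = 0)
        (_ : gradient (NoisyGD.empRisk f X') θs' = 0),
        (∀ θ,
          Integrable (NoisyGD.lyap p θs) (NoisyGD.gdKernel η σ (NoisyGD.empRisk f X) ν θ) ∧
          Integrable (NoisyGD.lyap p θs) (NoisyGD.gdKernel η σ (NoisyGD.empRisk f X') ν θ)) ∧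
        NoisyGD.kernelDist (NoisyGD.lyap p θs) (NoisyGD.lyap (1 + p) θs')
            (NoisyGD.gdKernel η σ (NoisyGD.empRisk f X) ν)
            (NoisyGD.gdKernel η σ (NoisyGD.empRisk f X') ν)
          ≤ ENNReal.ofReal (C / n) :=
  have hpα : p < α := by linarith [hp.2.trans_le (min_le_right _ _)]
  mainTheorem3_general ⟨by linarith [hα.1], hα.2.le⟩ ⟨hp.1.le, hpα⟩ hσ.ne' hm ν hν
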